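/- Let $N\ge 2$ be an integer and let $\mathcal{A}$ be an arbitrary abelian category. Let $\mathrm{Mor}_{N-2}(\mathcal{A})$ be the category of diagrams $X_1\xrightarrow{\alpha_1}X_2\to\cdots\xrightarrow{\alpha_{N-2}}X_{N-1}$ in $\mathcal{A}$, with commuting ladders as morphisms. An $N$-complex over $\mathcal{A}$ is a sequence of morphisms $d^n\colon X^n\to X^{n+1}$ ($n\in\mathbb{Z}$) in which every composite of $N$ successive ones is zero; it is bounded if $X^n=0$ for $|n|\gg0$. Let $C^b_N(\mathcal{A})$ be the category of bounded $N$-complexes, with morphisms the sequences $f^n\colon X^n\to Y^n$ commuting with the differentials. Write $d^{n,r}=d^{n+r-1}\cdots d^{n}$. A morphism $f\colon X\to Y$ is null-homotopic if there are morphisms $h^i\colon X^i\to Y^{i-N+1}$ with $$f^i=\sum_{j=1}^{N} d_Y^{i+j-N,\,N-j}\circ h^{i+j-1}\circ d_X^{i,\,j-1}\qquad(i\in\mathbb{Z}),$$ and the homotopy category $K^b_N(\mathcal{A})$ is the quotient of $C^b_N(\mathcal{A})$ by the null-homotopic morphisms. It is triangulated, the distinguished triangles being those isomorphic to the triangles $X\to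 Y\to Z\to\Sigma X$ attached to chainwise split short exact sequences $X\to Y\to Z$ of $N$-complexes. A complex $X$ is acyclic if $H^n_r(X)=\ker(d^{n,r})/\operatorname{im}(d^{n-N+r,\,N-r})$ is zero for all $n\in\mathbb{Z}$ and $1\le r<N$. The bounded derived category $D^b_N(\mathcal{A})$ is the Verdier quotient of $K^b_N(\mathcal{A})$ by the acyclic complexes, i.e. its localization at the morphisms whose cone is acyclic. Let $G\colon\mathrm{Mor}_{N-2}(\mathcal{A})\to C^b_N(\mathcal{A})$ be the functor that regards a diagram $X_1\to\cdots\to X_{N-1}$ as an $N$-complex with $X_i$ in degree $i$ for $1\le i\le N-1$, the morphisms $\alpha_i$ as differentials, and zero in all other degrees. Then the composition $$\mathrm{Mor}_{N-2}(\mathcal{A})\xrightarrow{\;G\;}C^b_N(\mathcal{A})\longrightarrow D^b_N(\mathcal{A})$$ is fully faithful. -/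

import Mathlib

open CategoryTheory CategoryTheory.Limits
open scoped ZeroObject

universe v u

noncomputable section

namespace NCx

section Additive

variable (A : Type u) [Category.{v} A] [Preadditive A]

/-- A functor `F` from the ordered set `ℤ` to `A` is the same thing as a sequence of objects
`F.obj n` together with differentials `F.obj n ⟶ F.obj (n + 1)`; its value on `n ≤ n + r` is then the
composite of the `r` successive differentials starting at `n`. It is an `N`-complex when the
composite of any `N` successive differentials vanishes. -/
def isNComplex (N : ℕ) : ObjectProperty (ℤ ⥤ A) :=
  fun F => ∀ n : ℤ, F.map (homOfLE (show n ≤ n + (N : ℤ) by lia)) = 0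

/-- `F n = 0` for all `n` of large absolute value. -/
def isBounded : ObjectProperty (ℤ ⥤ A) :=
  fun F => ∃ b : ℤ, ∀ n : ℤ, b < |n| → IsZero (F.obj n)

/-- The category `C^b_N(A)` of bounded `N`-complexes over `A`. -/
abbrev BoundedNComplex (N : ℕ) : Type (max u v) :=
  (isNComplex A N ⊓ isBounded A).FullSubcategory

variable {A} {N : ℕ}

/-- The component of a bounded `N`-complex in degree `n`, as a functor. -/
abbrev degree (A : Type u) [Category.{v} A] [Preadditive A] (N : ℕ) (n : ℤ) :
    BoundedNComplex A N ⥤ A :=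
  (isNComplex A N ⊓ isBounded A).ι ⋙ (evaluation ℤ A).obj n

instance (n : ℤ) : (degree A N n).PreservesZeroMorphisms where
  map_zero _ _ := rfl

/-- The composite of successive differentials of `K` from degree `m` to degree `n`. -/
abbrev diff (K : BoundedNComplex A N) (m n : ℤ) (h : m ≤ n) :
    (degree A N m).obj K ⟶ (degree A N n).obj K :=
  K.obj.map (homOfLE h)

/-- `f` is null-homotopic: there are `h^m : X^m ⟶ Y^(m-N+1)` such that
`f^i = ∑_{j=1}^N d_Y^{i+j-N, N-j} ∘ h^{i+j-1} ∘ d_X^{i, j-1}`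
(the summation index below is `j - 1`). -/
def NullHomotopic {X Y : BoundedNComplex A N} (f : X ⟶ Y) : Prop :=
  ∃ h : ∀ m : ℤ, (degree A N m).obj X ⟶ (degree A N (m - N + 1)).obj Y,
    ∀ i : ℤ, (degree A N i).map f =
      ∑ j : Fin N, diff X i (i + (j : ℕ)) (by lia) ≫ h (i + (j : ℕ)) ≫
        diff Y (i + (j : ℕ) - N + 1) i (by have := j.isLt; lia)

/-- Two morphisms are homotopic if their difference is null-homotopic. -/
def homotopic (A : Type u) [Category.{v} A] [Preadditive A] (N : ℕ) :
    HomRel (BoundedNComplex A N) :=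
  fun _ _ f g => NullHomotopic (f - g)

lemma diff_naturality {X Y : BoundedNComplex A N} (f : X ⟶ Y) (m n : ℤ) (h : m ≤ n) :
    diff X m n h ≫ (degree A N n).map f = (degree A N m).map f ≫ diff Y m n h :=
  f.hom.naturality (homOfLE h)

lemma NullHomotopic.zero (X Y : BoundedNComplex A N) : NullHomotopic (0 : X ⟶ Y) :=
  ⟨fun _ => 0, fun i => by simp⟩

lemma NullHomotopic.neg {X Y : BoundedNComplex A N} {f : X ⟶ Y} (hf : NullHomotopic f) :
    NullHomotopic (-f) := by
  obtain ⟨h, hh⟩ := hf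
  refine ⟨fun m => - h m, fun i => ?_⟩
  have : (degree A N i).map (-f) = -(degree A N i).map f := rfl
  rw [this, hh]
  simp

lemma NullHomotopic.add {X Y : BoundedNComplex A N} {f g : X ⟶ Y} (hf : NullHomotopic f)
    (hg : NullHomotopic g) : NullHomotopic (f + g) := by
  obtain ⟨h, hh⟩ := hf
  obtain ⟨k, hk⟩ := hg
  refine ⟨fun m => h m + k m, fun i => ?_⟩
  have : (degree A N i).map (f + g) = (degree A N i).map f + (degree A N i).map g := rfl
  rw [this, hh, hk]
  simp [Finset.sum_add_distrib]

lemma NullHomotopic.precomp {X Y Z : BoundedNComplex A N} (g : X ⟶ Y) {f : Y ⟶ Z}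
    (hf : NullHomotopic f) : NullHomotopic (g ≫ f) := by
  obtain ⟨h, hh⟩ := hf
  refine ⟨fun m => (degree A N m).map g ≫ h m, fun i => ?_⟩
  rw [Functor.map_comp, hh, Preadditive.comp_sum]
  refine Finset.sum_congr rfl fun j _ => ?_
  rw [← Category.assoc, ← diff_naturality]
  simp only [Category.assoc]

lemma NullHomotopic.postcomp {X Y Z : BoundedNComplex A N} {f : X ⟶ Y}
    (hf : NullHomotopic f) (g : Y ⟶ Z) : NullHomotopic (f ≫ g) := by
  obtain ⟨h, hh⟩ := hf
  refine ⟨fun m => h m ≫ (degree A N _).map g, fun i => ?_⟩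
  rw [Functor.map_comp, hh, Preadditive.sum_comp]
  refine Finset.sum_congr rfl fun j _ => ?_
  simp only [Category.assoc]
  rw [diff_naturality]

instance : Congruence (homotopic A N) where
  equivalence :=
    { refl := fun f => by
        change NullHomotopic (f - f)
        rw [sub_self]; exact .zero _ _
      symm := fun {f g} h => by
        change NullHomotopic (g - f)
        rw [← neg_sub]; exact h.neg
      trans := fun {f g k} h h' => by
        change NullHomotopic (f - k)
        rw [← sub_add_sub_cancel f g k]; exact h.add h' }
  comp_left f _ _ h := by
    change NullHomotopic (f ≫ _ - f ≫ _)
    rw [← Preadditive.comp_sub]; exact h.precomp f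
  comp_right g h := by
    change NullHomotopic (_ ≫ g - _ ≫ g)
    rw [← Preadditive.sub_comp]; exact h.postcomp g

/-- The homotopy category `K^b_N(A)` of bounded `N`-complexes. -/
abbrev HomotopyCat (A : Type u) [Category.{v} A] [Preadditive A] (N : ℕ) : Type (max u v) :=
  Quotient (homotopic A N)

/-- The projection `C^b_N(A) ⥤ K^b_N(A)`. -/
abbrev toHomotopyCat (A : Type u) [Category.{v} A] [Preadditive A] (N : ℕ) :
    BoundedNComplex A N ⥤ HomotopyCat A N :=
  Quotient.functor (homotopic A N)

/-- A sequence `X ⟶ Y ⟶ Z` of bounded `N`-complexes is a chainwise split short exact sequence. -/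
def ChainwiseSplit (S : ShortComplex (BoundedNComplex A N)) : Prop :=
  ∀ n : ℤ, Nonempty (S.map (degree A N n)).Splitting

end Additive

section Abelian

variable {A : Type u} [Category.{v} A] [Abelian A] {N : ℕ}

/-- The sequence `K^{n-N+r} ⟶ K^n ⟶ K^{n+r}` of composites of differentials. -/
def homologySequence (K : BoundedNComplex A N) (n : ℤ) (r : ℕ) (hr : r ≤ N) : ShortComplex A :=
  ShortComplex.mk (diff K (n - N + r) n (by lia)) (diff K n (n + r) (by lia)) (by
    have e : n - N + r + N = n + r := by ring
    have h := K.property.1 (n - N + r)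
    have aux : ∀ (m : ℤ) (_ : n - N + r + N = m) (hm : n - N + r ≤ m),
        K.obj.map (homOfLE hm) = 0 := by
      rintro m rfl hm
      exact h
    have h2 := aux (n + r) e (by lia)
    rw [← h2]
    change K.obj.map _ ≫ K.obj.map _ = _
    rw [← K.obj.map_comp]
    rfl)

/-- The homology object `H^n_r(K) = ker (d^{n,r}) / im (d^{n-N+r,N-r})`. -/
def homologyObj (K : BoundedNComplex A N) (n : ℤ) (r : ℕ) (hr : r ≤ N) : A :=
  (homologySequence K n r hr).homology

/-- A bounded `N`-complex is acyclic if `H^n_r = 0` for all `n` and all `1 ≤ r < N`. -/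
def Acyclic (K : BoundedNComplex A N) : Prop :=
  ∀ (n : ℤ) (r : ℕ) (_ : 1 ≤ r) (hr : r < N), IsZero (homologyObj K n r hr.le)

/-- The morphisms of `K^b_N(A)` with acyclic cone. The distinguished triangles of `K^b_N(A)` are
those isomorphic to the triangle `X ⟶ Y ⟶ Z ⟶ ΣX` attached to some chainwise split short exact
sequence `X ⟶ Y ⟶ Z` of complexes; so `f` has an acyclic cone when, up to isomorphism of arrows of
`K^b_N(A)`, it is the first map of such a sequence in which `Z` is acyclic. -/
def acyclicCone (A : Type u) [Category.{v} A] [Abelian A] (N : ℕ) :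
    MorphismProperty (HomotopyCat A N) :=
  fun _ _ f => ∃ S : ShortComplex (BoundedNComplex A N),
    ChainwiseSplit S ∧ Acyclic S.X₃ ∧
      Nonempty (Arrow.mk f ≅ Arrow.mk ((toHomotopyCat A N).map S.f))

/-- The bounded derived category `D^b_N(A)` of `N`-complexes: the Verdier quotient of `K^b_N(A)` by
the acyclic complexes, i.e. the localization of `K^b_N(A)` at the morphisms with acyclic cone. -/
abbrev DerivedCat (A : Type u) [Category.{v} A] [Abelian A] (N : ℕ) : Type (max u v) :=
  (acyclicCone A N).Localization

/-- The functor `C^b_N(A) ⥤ D^b_N(A)`. -/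
abbrev toDerivedCat (A : Type u) [Category.{v} A] [Abelian A] (N : ℕ) :
    BoundedNComplex A N ⥤ DerivedCat A N :=
  toHomotopyCat A N ⋙ (acyclicCone A N).Q

/-- The object in degree `n` of the extension by zero of a diagram `X_1 ⟶ ⋯ ⟶ X_{k+1}`: it is
`X_n` for `1 ≤ n ≤ k + 1` and `0` otherwise. (`ComposableArrows` numbers the objects from `0`.) -/
def extObj {k : ℕ} (X : ComposableArrows A k) (n : ℤ) : A :=
  if h : 1 ≤ n ∧ n ≤ k + 1 then X.obj ⟨(n - 1).toNat, by lia⟩ else 0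

lemma extObj_eq {k : ℕ} (X : ComposableArrows A k) (n : ℤ) (h : 1 ≤ n ∧ n ≤ k + 1) :
    extObj X n = X.obj ⟨(n - 1).toNat, by lia⟩ := dif_pos h

lemma isZero_extObj {k : ℕ} (X : ComposableArrows A k) (n : ℤ) (h : ¬ (1 ≤ n ∧ n ≤ k + 1)) :
    IsZero (extObj X n) := by
  rw [extObj, dif_neg h]
  exact isZero_zero A

/-- The maps of the extension by zero. -/
def extMap {k : ℕ} (X : ComposableArrows A k) (m n : ℤ) (hmn : m ≤ n) :
    extObj X m ⟶ extObj X n :=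
  if h : 1 ≤ m ∧ n ≤ k + 1 then
    eqToHom (extObj_eq X m ⟨h.1, by lia⟩) ≫
      X.map (homOfLE (show (m - 1).toNat ≤ (n - 1).toNat by lia)) ≫
        eqToHom (extObj_eq X n ⟨by lia, h.2⟩).symm
  else 0

/-- The extension by zero of a diagram `X_1 ⟶ ⋯ ⟶ X_{k+1}` to a sequence indexed by `ℤ`,
with `X_i` in degree `i`. -/
def extSeq {k : ℕ} (X : ComposableArrows A k) : ℤ ⥤ A where
  obj n := extObj X n
  map {m n} f := extMap X m n (leOfHom f)
  map_id n := by
    by_cases h : 1 ≤ n ∧ n ≤ k + 1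
    · rw [extMap, dif_pos h]
      have e : (homOfLE le_rfl : (⟨(n - 1).toNat, by lia⟩ : Fin (k + 1)) ⟶ _) = 𝟙 _ := rfl
      erw [e, X.map_id]
      simp
    · exact (isZero_extObj X n h).eq_of_src _ _
  map_comp {l m n} f g := by
    have hf := leOfHom f
    have hg := leOfHom g
    by_cases h : 1 ≤ l ∧ n ≤ k + 1
    · rw [extMap, extMap, extMap, dif_pos h, dif_pos ⟨h.1, by lia⟩, dif_pos ⟨by lia, h.2⟩]
      simp only [Category.assoc, eqToHom_trans_assoc, eqToHom_refl, Category.id_comp]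
      rw [← X.map_comp_assoc]
      rfl
    · by_cases h1 : 1 ≤ l
      · exact (isZero_extObj X n (by tauto)).eq_of_tgt _ _
      · exact (isZero_extObj X l (by tauto)).eq_of_src _ _

/-- The map in degree `n` induced by a morphism of diagrams. -/
def extHomApp {k : ℕ} {X Y : ComposableArrows A k} (f : X ⟶ Y) (n : ℤ) :
    extObj X n ⟶ extObj Y n :=
  if h : 1 ≤ n ∧ n ≤ k + 1 then
    eqToHom (extObj_eq X n h) ≫ f.app _ ≫ eqToHom (extObj_eq Y n h).symm
  else 0

/-- Extension by zero, as a functor. -/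
def extFunctor (A : Type u) [Category.{v} A] [Abelian A] (k : ℕ) :
    ComposableArrows A k ⥤ (ℤ ⥤ A) where
  obj X := extSeq X
  map {X Y} f :=
    { app := extHomApp f
      naturality := fun m n a => by
        have ha := leOfHom a
        change extMap X m n ha ≫ _ = _ ≫ extMap Y m n ha
        by_cases h : 1 ≤ m ∧ n ≤ k + 1
        · rw [extMap, extMap, extHomApp, extHomApp, dif_pos h, dif_pos h,
            dif_pos ⟨by lia, h.2⟩, dif_pos ⟨h.1, by lia⟩]
          simp
        · by_cases h1 : 1 ≤ m
          · exact (isZero_extObj Y n (by tauto)).eq_of_tgt _ _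
          · exact (isZero_extObj X m (by tauto)).eq_of_src _ _ }
  map_id X := by
    ext n
    change extHomApp (𝟙 X) n = 𝟙 (extObj X n)
    by_cases h : 1 ≤ n ∧ n ≤ k + 1
    · rw [extHomApp, dif_pos h]
      simp
    · exact (isZero_extObj X n h).eq_of_src _ _
  map_comp {X Y Z} f g := by
    ext n
    change extHomApp (f ≫ g) n = extHomApp f n ≫ extHomApp g n
    by_cases h : 1 ≤ n ∧ n ≤ k + 1
    · rw [extHomApp, extHomApp, extHomApp, dif_pos h, dif_pos h, dif_pos h]
      simp
    · exact (isZero_extObj X n h).eq_of_src _ _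

lemma ext_isNComplex {N : ℕ} (hN : 2 ≤ N) (X : ComposableArrows A (N - 2)) :
    (isNComplex A N ⊓ isBounded A) (extSeq X) := by
  refine ⟨fun n => ?_, N, fun n hn => ?_⟩
  · by_cases h : 1 ≤ n
    · exact (isZero_extObj X (n + N) (by lia)).eq_of_tgt _ _
    · exact (isZero_extObj X n (by lia)).eq_of_src _ _
  · refine isZero_extObj X n fun h => ?_
    rw [abs_of_nonneg (by lia)] at hn
    lia

/-- The functor `G : Mor_{N-2}(A) ⥤ C^b_N(A)` which views a diagram `X_1 ⟶ ⋯ ⟶ X_{N-1}` as an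
`N`-complex with `X_i` in degree `i`, concentrated in degrees `1` through `N - 1`. -/
def G (A : Type u) [Category.{v} A] [Abelian A] (N : ℕ) (hN : 2 ≤ N) :
    ComposableArrows A (N - 2) ⥤ BoundedNComplex A N :=
  (isNComplex A N ⊓ isBounded A).lift (extFunctor A (N - 2)) (ext_isNComplex hN)

/-- The inclusion of `{1 < ⋯ < N - 1}` into `ℤ`, for index sets starting at `0`. -/
def degreeInclusion (N : ℕ) : Fin (N - 2 + 1) ⥤ ℤ :=
  Monotone.functor (f := fun i => ((i : ℕ) : ℤ) + 1) fun i j h => by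
    have : (i : ℕ) ≤ (j : ℕ) := h
    dsimp only
    lia

end Abelian

end NCx

end

/-!
The degrees `1, …, N - 1` of an `N`-complex `K` can be cut out in a way that is natural in the
derived category. Let `trunc K` be the subcomplex `ker (K^i ⟶ K^{max i N})`, and let `core K` be the
quotient of `trunc K` by the image of its part in degrees `≤ 0`. Then `core K` is concentrated in
the degrees `1, …, N - 1`, where it consists of the homology objects of `K^0 ⟶ K^i ⟶ K^N`; so it is
`G` of a diagram `Ψ K`. There is a natural span `K ⟵ trunc K ⟶ G (Ψ K)`, both maps of which are
isomorphisms of complexes if `K` is itself of the form `G X`.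

This span descends to the derived category. Homotopies restrict to truncations
(`NullHomotopic.trunc`) and null-homotopic maps vanish on cores (`coreMap_eq_zero`). Truncation
preserves quasi-isomorphisms (`QuasiIso.trunc`), and cores turn them into isomorphisms
(`QuasiIso.isIso_coreMap`). Hence a morphism `f : G X ⟶ G Y` of the derived category is conjugate,
through the two spans, to `G (Ψ f)`, which gives fullness; and `Ψ (G X) ≅ X` gives faithfulness
(`full_and_faithful_of_span`). No calculus of fractions is needed.

The remaining point is that quasi-isomorphisms are inverted in the derived category, although a
truncated chainwise split sequence need not be chainwise split. Here a morphism `X ⟶ Y` is factored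
through the direct sum of `Y` and a contractible complex into which `X` embeds chainwise split
(`hull`): the first factor has acyclic cokernel if `X ⟶ Y` is a quasi-isomorphism, and the second
one is a homotopy equivalence.

Homology is handled throughout by generalized elements, up to epimorphic covers of their sources.
-/

noncomputable section

namespace NCx

/-! ### Differentials and isomorphisms on homology -/

section Differentials

variable {A : Type u} [Category.{v} A]

/-- The composite of successive differentials of a sequence, from degree `m` to degree `n`. -/
def d (K : ℤ ⥤ A) (m n : ℤ) (h : m ≤ n := by lia) : K.obj m ⟶ K.obj n := K.map (homOfLE h)

lemma map_eq_d (K : ℤ ⥤ A) {m n : ℤ} (f : m ⟶ n) : K.map f = d K m n (leOfHom f) := rfl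

@[simp]
lemma d_self (K : ℤ ⥤ A) (n : ℤ) (h : n ≤ n) : d K n n h = 𝟙 _ := K.map_id n

@[simp]
lemma d_comp (K : ℤ ⥤ A) (l m n : ℤ) (h : l ≤ m) (h' : m ≤ n) :
    d K l m h ≫ d K m n h' = d K l n (h.trans h') := (K.map_comp _ _).symm

@[simp]
lemma d_comp_assoc (K : ℤ ⥤ A) (l m n : ℤ) (h : l ≤ m) (h' : m ≤ n) {T : A} (x : K.obj n ⟶ T) :
    d K l m h ≫ d K m n h' ≫ x = d K l n (h.trans h') ≫ x := by
  rw [← d_comp K l m n h h', Category.assoc]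

lemma d_naturality {K L : ℤ ⥤ A} (f : K ⟶ L) (m n : ℤ) (h : m ≤ n) :
    d K m n h ≫ f.app n = f.app m ≫ d L m n h := f.naturality _

lemma d_naturality_assoc {K L : ℤ ⥤ A} (f : K ⟶ L) (m n : ℤ) (h : m ≤ n) {T : A}
    (x : L.obj n ⟶ T) : d K m n h ≫ f.app n ≫ x = f.app m ≫ d L m n h ≫ x := by
  rw [← Category.assoc, d_naturality, Category.assoc]

lemma d_eq_zero [Preadditive A] {N : ℕ} {K : ℤ ⥤ A} (hK : isNComplex A N K) (m n : ℤ) (h : m ≤ n)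
    (hmn : m + N ≤ n) : d K m n h = 0 := by
  rw [← d_comp K m (m + N) n (by lia) hmn, show d K m (m + N) _ = 0 from hK m, zero_comp]

end Differentials

section Homology

variable {A : Type u} [Category.{v} A] [Abelian A]

/-- Exactness of `K^a ⟶ K^b ⟶ K^c` in terms of generalized elements: a generalized element of
`K^b` killed in `K^c` comes, after passing to an epimorphic cover of its source, from `K^a`. -/
def ExactAt (K : ℤ ⥤ A) (a b c : ℤ) (hab : a < b) (hbc : b < c) : Prop :=
  ∀ ⦃T : A⦄ (x : T ⟶ K.obj b), x ≫ d K b c = 0 →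
    ∃ (T' : A) (π : T' ⟶ T) (_ : Epi π) (y : T' ⟶ K.obj a), π ≫ x = y ≫ d K a b

/-- A morphism of `N`-complexes inducing isomorphisms on all `H^n_r` with `1 ≤ r < N`. Surjectivity
and injectivity are expressed by generalized elements, up to epimorphic covers of their sources;
the homology at `b` of `K^a ⟶ K^b ⟶ K^c`, where `a < b < c = a + N`, is `H^b_{c-b}`. -/
structure QuasiIso (N : ℕ) {K L : ℤ ⥤ A} (f : K ⟶ L) : Prop where
  surj : ∀ (a b c : ℤ) (hab : a < b) (hbc : b < c) (_ : c = a + N) ⦃T : A⦄ (y : T ⟶ L.obj b),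
    y ≫ d L b c = 0 → ∃ (T' : A) (π : T' ⟶ T) (_ : Epi π) (x : T' ⟶ K.obj b) (z : T' ⟶ L.obj a),
      x ≫ d K b c = 0 ∧ π ≫ y = x ≫ f.app b + z ≫ d L a b
  inj : ∀ (a b c : ℤ) (hab : a < b) (hbc : b < c) (_ : c = a + N) ⦃T : A⦄ (x : T ⟶ K.obj b)
    (z : T ⟶ L.obj a), x ≫ d K b c = 0 → x ≫ f.app b = z ≫ d L a b →
      ∃ (T' : A) (π : T' ⟶ T) (_ : Epi π) (w : T' ⟶ K.obj a), π ≫ x = w ≫ d K a b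

variable {N : ℕ}

lemma isZero_homologyObj_iff (K : BoundedNComplex A N) (n : ℤ) (r : ℕ) (hr : 1 ≤ r) (hrN : r < N) :
    IsZero (homologyObj K n r hrN.le) ↔ ExactAt K.obj (n - N + r) n (n + r) (by lia) (by lia) := by
  rw [homologyObj, ← ShortComplex.exact_iff_isZero_homology,
    ShortComplex.exact_iff_exact_up_to_refinements]
  rfl

lemma acyclic_iff_exactAt (K : BoundedNComplex A N) :
    Acyclic K ↔ ∀ (a b c : ℤ) (hab : a < b) (hbc : b < c) (_ : c = a + N),
      ExactAt K.obj a b c hab hbc := by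
  constructor
  · intro h a b c hab hbc hc
    obtain ⟨r, rfl⟩ : ∃ r : ℕ, c = b + r := ⟨(c - b).toNat, by lia⟩
    obtain rfl : a = b - N + r := by lia
    exact (isZero_homologyObj_iff K b r (by lia) (by lia)).1 (h b r (by lia) (by lia))
  · intro h n r hr hrN
    exact (isZero_homologyObj_iff K n r hr hrN).2 (h _ _ _ _ _ (by lia))

lemma nullHomotopic_iff {X Y : BoundedNComplex A N} (f : X ⟶ Y) :
    NullHomotopic f ↔ ∃ h : ∀ m : ℤ, X.obj.obj m ⟶ Y.obj.obj (m - N + 1), ∀ i : ℤ,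
      f.hom.app i = ∑ j : Fin N, d X.obj i (i + (j : ℕ)) ≫ h (i + (j : ℕ)) ≫
        d Y.obj (i + (j : ℕ) - N + 1) i (by have := j.isLt; lia) := Iff.rfl

/-- A null-homotopic morphism is zero on homology: the summands of the homotopy formula that do not
vanish on a cycle factor through `Y^a`. -/
lemma NullHomotopic.exists_eq_comp_d {X Y : BoundedNComplex A N} {f : X ⟶ Y} (hf : NullHomotopic f)
    (a b c : ℤ) (hab : a ≤ b) (hbc : b ≤ c) (hc : c = a + N) {T : A} (x : T ⟶ X.obj.obj b)
    (hx : x ≫ d X.obj b c = 0) : ∃ z : T ⟶ Y.obj.obj a, x ≫ f.hom.app b = z ≫ d Y.obj a b := by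
  obtain ⟨h, hh⟩ := (nullHomotopic_iff f).1 hf
  have key : ∀ j : Fin N, ∃ z : T ⟶ Y.obj.obj a, x ≫ d X.obj b (b + (j : ℕ)) ≫ h (b + (j : ℕ)) ≫
      d Y.obj (b + (j : ℕ) - N + 1) b (by have := j.isLt; lia) = z ≫ d Y.obj a b := by
    intro j
    by_cases hj : b + (j : ℕ) < c
    · refine ⟨x ≫ d X.obj b (b + (j : ℕ)) ≫ h (b + (j : ℕ)) ≫
        d Y.obj (b + (j : ℕ) - N + 1) a (by lia), ?_⟩
      simp only [Category.assoc, d_comp]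
    · refine ⟨0, ?_⟩
      rw [← d_comp X.obj b c (b + (j : ℕ)) hbc (by lia), Category.assoc, reassoc_of% hx,
        zero_comp, zero_comp]
  choose z hz using key
  refine ⟨∑ j, z j, ?_⟩
  rw [hh, Preadditive.comp_sum, Preadditive.sum_comp]
  exact Finset.sum_congr rfl fun j _ => hz j

lemma ChainwiseSplit.mono_app {S : ShortComplex (BoundedNComplex A N)} (hS : ChainwiseSplit S)
    (n : ℤ) : Mono (S.f.hom.app n) :=
  (hS n).some.shortExact.mono_f

lemma ChainwiseSplit.exists_lift {S : ShortComplex (BoundedNComplex A N)} (hS : ChainwiseSplit S)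
    {n : ℤ} {T : A} (z : T ⟶ S.X₃.obj.obj n) :
    ∃ y : T ⟶ S.X₂.obj.obj n, y ≫ S.g.hom.app n = z := by
  obtain ⟨s⟩ := hS n
  refine ⟨z ≫ s.s, ?_⟩
  have := s.s_g
  exact (Category.assoc _ _ _).trans ((congrArg (z ≫ ·) this).trans (Category.comp_id z))

lemma ChainwiseSplit.exists_factor {S : ShortComplex (BoundedNComplex A N)} (hS : ChainwiseSplit S)
    {n : ℤ} {T : A} (y : T ⟶ S.X₂.obj.obj n) (hy : y ≫ S.g.hom.app n = 0) :
    ∃ x : T ⟶ S.X₁.obj.obj n, y = x ≫ S.f.hom.app n := by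
  obtain ⟨s⟩ := hS n
  have := s.shortExact.mono_f
  exact ⟨s.shortExact.exact.lift y hy, (s.shortExact.exact.lift_f y hy).symm⟩

lemma comp_app_eq_zero (S : ShortComplex (BoundedNComplex A N)) (n : ℤ) :
    S.f.hom.app n ≫ S.g.hom.app n = 0 :=
  congrArg (fun φ : S.X₁ ⟶ S.X₃ => φ.hom.app n) S.zero

/-- In a chainwise split short exact sequence with acyclic quotient, the first map is a
quasi-isomorphism. -/
lemma ChainwiseSplit.quasiIso {S : ShortComplex (BoundedNComplex A N)} (hS : ChainwiseSplit S)
    (hZ : Acyclic S.X₃) : QuasiIso N S.f.hom := by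
  rw [acyclic_iff_exactAt] at hZ
  have hN := S.X₂.property.1
  constructor
  · intro a b c hab hbc hc T y hy
    obtain ⟨T', π, hπ, z, hz⟩ := hZ a b c hab hbc hc (y ≫ S.g.hom.app b) (by
      rw [Category.assoc, ← d_naturality, reassoc_of% hy, zero_comp])
    obtain ⟨y', rfl⟩ := hS.exists_lift z
    obtain ⟨x, hx⟩ := hS.exists_factor (π ≫ y - y' ≫ d S.X₂.obj a b) (by
      simp [hz, d_naturality])
    refine ⟨T', π, hπ, x, y', ?_, by rw [← hx]; abel⟩
    have := hS.mono_app c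
    rw [← cancel_mono (S.f.hom.app c), Category.assoc, d_naturality, ← Category.assoc, ← hx]
    simp [hy, d_eq_zero hN a c (by lia) (by lia)]
  · intro a b c hab hbc hc T x y hx hy
    obtain ⟨T', π, hπ, z, hz⟩ := hZ (b - N) a b (by lia) hab (by lia) (y ≫ S.g.hom.app a) (by
      rw [Category.assoc, ← d_naturality, ← Category.assoc, ← hy, Category.assoc,
        comp_app_eq_zero, comp_zero])
    obtain ⟨y', rfl⟩ := hS.exists_lift z
    obtain ⟨w, hw⟩ := hS.exists_factor (π ≫ y - y' ≫ d S.X₂.obj (b - N) a) (by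
      simp [hz, d_naturality])
    refine ⟨T', π, hπ, w, ?_⟩
    have := hS.mono_app b
    rw [← cancel_mono (S.f.hom.app b), Category.assoc, Category.assoc, d_naturality,
      ← Category.assoc w, ← hw, hy]
    simp [d_eq_zero hN (b - N) b (by lia) (by lia)]

/-- In a chainwise split short exact sequence whose first map is a quasi-isomorphism, the quotient
is acyclic. -/
lemma ChainwiseSplit.acyclic {S : ShortComplex (BoundedNComplex A N)} (hS : ChainwiseSplit S)
    (hf : QuasiIso N S.f.hom) : Acyclic S.X₃ := by
  rw [acyclic_iff_exactAt]
  intro a b c hab hbc hc T z hz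
  have hN := S.X₂.property.1
  obtain ⟨y, rfl⟩ := hS.exists_lift z
  obtain ⟨x, hx⟩ := hS.exists_factor (y ≫ d S.X₂.obj b c) (by
    rw [Category.assoc, d_naturality, ← Category.assoc, hz])
  obtain ⟨T', π, _, w, hw⟩ := hf.inj b c (b + N) hbc (by lia) rfl x y (by
    have := hS.mono_app (b + N)
    rw [← cancel_mono (S.f.hom.app (b + N)), Category.assoc, d_naturality, ← Category.assoc, ← hx]
    simp [d_eq_zero hN b (b + N) (by lia) (by lia)]) hx.symm
  obtain ⟨T'', π', _, u, v, -, huv⟩ := hf.surj a b c hab hbc hc (π ≫ y - w ≫ S.f.hom.app b) (by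
    rw [Preadditive.sub_comp, Category.assoc, Category.assoc, hx, ← d_naturality,
      ← Category.assoc, hw, Category.assoc, sub_self])
  refine ⟨T'', π' ≫ π, epi_comp _ _, v ≫ S.g.hom.app a, ?_⟩
  have e := congrArg (· ≫ S.g.hom.app b) huv
  simpa [comp_app_eq_zero, d_naturality] using e

end Homology

/-! ### The contractible hull -/

section Hull

variable {A : Type u} [Category.{v} A] [Abelian A]

/-- The object `∏_{n ≤ k < n + N} K^k`. -/
abbrev hullObj (N : ℕ) (K : ℤ ⥤ A) (n : ℤ) : A :=
  ∏ᶜ fun k : Set.Ico n (n + N) => K.obj k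

/-- The contractible hull `n ↦ ∏_{n ≤ k < n + N} K^k` of a sequence, whose differentials forget one
factor and are zero on the new one: it is the product over `k` of the `N`-complexes
`K^k = ⋯ = K^k` in degrees `k - N + 1, …, k`. -/
def hull (N : ℕ) (K : ℤ ⥤ A) : ℤ ⥤ A where
  obj n := hullObj N K n
  map {m n} f := Pi.lift fun k => if h : (k : ℤ) < m + N then
    Pi.π (fun k : Set.Ico m (m + N) => K.obj k) ⟨k, (leOfHom f).trans k.2.1, h⟩ else 0
  map_id n := by
    refine Pi.hom_ext _ _ fun k => ?_
    rw [Pi.lift_π, dif_pos k.2.2, Category.id_comp]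
  map_comp {l m n} f g := by
    have := leOfHom f
    refine Pi.hom_ext _ _ fun k => ?_
    rw [Category.assoc, Pi.lift_π, Pi.lift_π]
    by_cases h : (k : ℤ) < m + N
    · rw [dif_pos h, Pi.lift_π]
    · rw [dif_neg h, dif_neg (by lia), comp_zero]

/-- The projection of the hull in degree `n` to its factor `K^k`. -/
def hullπ (N : ℕ) (K : ℤ ⥤ A) (n k : ℤ) (h : n ≤ k ∧ k < n + N) : (hull N K).obj n ⟶ K.obj k :=
  Pi.π (fun k : Set.Ico n (n + N) => K.obj k) ⟨k, h⟩

/-- The morphism to the hull in degree `n` with given components. -/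
def hullLift (N : ℕ) (K : ℤ ⥤ A) (n : ℤ) {T : A}
    (φ : ∀ k : ℤ, n ≤ k ∧ k < n + N → (T ⟶ K.obj k)) : T ⟶ (hull N K).obj n :=
  Pi.lift fun k : Set.Ico n (n + N) => φ k k.2

variable {N : ℕ} {K : ℤ ⥤ A}

@[simp]
lemma hullLift_π (n : ℤ) {T : A} (φ : ∀ k : ℤ, n ≤ k ∧ k < n + N → (T ⟶ K.obj k)) (k : ℤ)
    (h : n ≤ k ∧ k < n + N) : hullLift N K n φ ≫ hullπ N K n k h = φ k h :=
  Pi.lift_π _ _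

lemma hull_hom_ext {n : ℤ} {T : A} {f g : T ⟶ (hull N K).obj n}
    (h : ∀ (k : ℤ) (hk : n ≤ k ∧ k < n + N), f ≫ hullπ N K n k hk = g ≫ hullπ N K n k hk) : f = g :=
  Pi.hom_ext _ _ fun k => h k k.2

lemma d_hullπ (m n : ℤ) (hmn : m ≤ n) (k : ℤ) (h : n ≤ k ∧ k < n + N) :
    d (hull N K) m n hmn ≫ hullπ N K n k h =
      if h' : k < m + N then hullπ N K m k ⟨by lia, h'⟩ else 0 :=
  Pi.lift_π _ _

variable (K) in
/-- The morphism from an `N`-complex to its hull whose components are composites of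
differentials. -/
def toHull (hK : isNComplex A N K) : K ⟶ hull N K where
  app n := hullLift N K n fun k h => d K n k h.1
  naturality m n f := by
    have hmn := leOfHom f
    refine hull_hom_ext fun k h => ?_
    rw [map_eq_d, map_eq_d, Category.assoc, Category.assoc, hullLift_π, d_hullπ, d_comp]
    split_ifs with h'
    · rw [hullLift_π]
    · rw [comp_zero, d_eq_zero hK _ _ _ (by lia)]

lemma toHull_π (hK : isNComplex A N K) (n : ℤ) (h : n < n + N) :
    (toHull K hK).app n ≫ hullπ N K n n ⟨le_rfl, h⟩ = 𝟙 _ :=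
  (hullLift_π n (fun k h => d K n k h.1) n ⟨le_rfl, h⟩).trans (d_self _ _ _)

variable (N K) in
lemma isNComplex_hull : isNComplex A N (hull N K) := by
  intro n
  refine hull_hom_ext fun k h => ?_
  rw [map_eq_d, d_hullπ, dif_neg (by lia), zero_comp]

lemma isBounded_hull (hK : isBounded A K) : isBounded A (hull N K) := by
  obtain ⟨b, hb⟩ := hK
  refine ⟨|b| + N, fun n hn => ?_⟩
  rw [IsZero.iff_id_eq_zero]
  refine hull_hom_ext fun k h => (hb k ?_).eq_of_tgt _ _
  have := le_abs_self b
  have := abs_sub_abs_le_abs_sub n k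
  have h2 : |n - k| ≤ N := abs_le.2 ⟨by lia, by lia⟩
  lia

/-- The hull of a bounded `N`-complex, as a bounded `N`-complex. -/
def hullComplex (X : BoundedNComplex A N) : BoundedNComplex A N :=
  ⟨hull N X.obj, isNComplex_hull N X.obj, isBounded_hull X.property.2⟩

variable (N K) in
/-- The homotopy in degree `m` picks out the factor `K^m`. -/
def hullHomotopy (m : ℤ) : (hull N K).obj m ⟶ (hull N K).obj (m - N + 1) :=
  hullLift N K (m - N + 1) fun k h =>
    if e : k = m then hullπ N K m k ⟨e.ge, by lia⟩ else 0

lemma id_hull_eq_sum (i : ℤ) : 𝟙 ((hull N K).obj i) =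
    ∑ j : Fin N, d (hull N K) i (i + (j : ℕ)) ≫ hullHomotopy N K (i + (j : ℕ)) ≫
      d (hull N K) (i + (j : ℕ) - N + 1) i (by have := j.isLt; lia) := by
  refine hull_hom_ext fun k h => ?_
  -- only the summand through degree `k` contributes to the component at `k`
  rw [Preadditive.sum_comp, Finset.sum_eq_single ⟨(k - i).toNat, by lia⟩]
  · have hk : i + ((k - i).toNat : ℤ) = k := by lia
    rw [Category.assoc, Category.assoc, d_hullπ, dif_pos (by dsimp only; lia), hullHomotopy,
      hullLift_π, dif_pos (by dsimp only; lia), d_hullπ, dif_pos (by lia), Category.id_comp]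
  · intro j _ hj
    have hj' : k ≠ i + (j : ℕ) := fun e => hj (Fin.ext (by simp [e]))
    rw [Category.assoc, Category.assoc, d_hullπ]
    split_ifs with h'
    · rw [hullHomotopy, hullLift_π, dif_neg hj', comp_zero]
    · rw [comp_zero, comp_zero]
  · simp

lemma nullHomotopic_id_hullComplex (X : BoundedNComplex A N) :
    NullHomotopic (𝟙 (hullComplex X)) :=
  (nullHomotopic_iff _).2 ⟨hullHomotopy N X.obj, id_hull_eq_sum⟩

end Hull

/-! ### Quasi-isomorphisms become invertible in the derived category -/

section Cylinder

variable {A : Type u} [Category.{v} A] [Abelian A] {N : ℕ}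

lemma biprod_total_app (K L : ℤ ⥤ A) (n : ℤ) {T : A} (x : T ⟶ (K ⊞ L).obj n) :
    (x ≫ (biprod.fst : K ⊞ L ⟶ K).app n) ≫ (biprod.inl : K ⟶ K ⊞ L).app n +
      (x ≫ (biprod.snd : K ⊞ L ⟶ L).app n) ≫ (biprod.inr : L ⟶ K ⊞ L).app n = x := by
  have : (biprod.fst : K ⊞ L ⟶ K).app n ≫ (biprod.inl : K ⟶ K ⊞ L).app n +
      (biprod.snd : K ⊞ L ⟶ L).app n ≫ (biprod.inr : L ⟶ K ⊞ L).app n = 𝟙 _ :=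
    congr_app (biprod.total (X := K) (Y := L)) n
  rw [Category.assoc, Category.assoc, ← Preadditive.comp_add, this, Category.comp_id]

lemma biprod_app_hom_ext {K L : ℤ ⥤ A} {n : ℤ} {T : A} {x y : T ⟶ (K ⊞ L).obj n}
    (h₁ : x ≫ (biprod.fst : K ⊞ L ⟶ K).app n = y ≫ (biprod.fst : K ⊞ L ⟶ K).app n)
    (h₂ : x ≫ (biprod.snd : K ⊞ L ⟶ L).app n = y ≫ (biprod.snd : K ⊞ L ⟶ L).app n) : x = y := by
  rw [← biprod_total_app K L n x, ← biprod_total_app K L n y, h₁, h₂]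

lemma isNComplex_biprod {K L : ℤ ⥤ A} (hK : isNComplex A N K) (hL : isNComplex A N L) :
    isNComplex A N (K ⊞ L) := by
  intro n
  refine biprod_app_hom_ext ?_ ?_
  · rw [NatTrans.naturality, hK n, comp_zero, zero_comp]
  · rw [NatTrans.naturality, hL n, comp_zero, zero_comp]

lemma isBounded_biprod {K L : ℤ ⥤ A} (hK : isBounded A K) (hL : isBounded A L) :
    isBounded A (K ⊞ L) := by
  obtain ⟨b, hb⟩ := hK
  obtain ⟨c, hc⟩ := hL
  refine ⟨max b c, fun n hn => ?_⟩
  rw [IsZero.iff_id_eq_zero]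
  exact biprod_app_hom_ext ((hb n (by lia)).eq_of_tgt _ _) ((hc n (by lia)).eq_of_tgt _ _)

/-- The mapping cylinder of a morphism `X ⟶ Y`: the direct sum of `Y` and the hull of `X`. -/
def cylinder (X Y : BoundedNComplex A N) : BoundedNComplex A N :=
  ⟨Y.obj ⊞ hull N X.obj, isNComplex_biprod Y.property.1 (isNComplex_hull N X.obj),
    isBounded_biprod Y.property.2 (isBounded_hull X.property.2)⟩

/-- The inclusion of the source of `f` into the mapping cylinder. -/
def toCylinder {X Y : BoundedNComplex A N} (f : X ⟶ Y) : X ⟶ cylinder X Y :=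
  ObjectProperty.homMk (biprod.lift f.hom (toHull X.obj X.property.1))

/-- The projection of the mapping cylinder of a morphism to its target. -/
def fromCylinder (X Y : BoundedNComplex A N) : cylinder X Y ⟶ Y :=
  ObjectProperty.homMk biprod.fst

/-- The inclusion of the target of a morphism into its mapping cylinder. -/
def inclCylinder (X Y : BoundedNComplex A N) : Y ⟶ cylinder X Y :=
  ObjectProperty.homMk biprod.inl

/-- The projection of the mapping cylinder to the hull of the source. -/
def cylinderToHull (X Y : BoundedNComplex A N) : cylinder X Y ⟶ hullComplex X :=
  ObjectProperty.homMk biprod.snd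

/-- The inclusion into the mapping cylinder of the hull of the source. -/
def hullToCylinder (X Y : BoundedNComplex A N) : hullComplex X ⟶ cylinder X Y :=
  ObjectProperty.homMk biprod.inr

lemma toCylinder_fromCylinder {X Y : BoundedNComplex A N} (f : X ⟶ Y) :
    toCylinder f ≫ fromCylinder X Y = f :=
  ObjectProperty.hom_ext _ (biprod.lift_fst _ _)

lemma inclCylinder_fromCylinder (X Y : BoundedNComplex A N) :
    inclCylinder X Y ≫ fromCylinder X Y = 𝟙 Y :=
  ObjectProperty.hom_ext _ biprod.inl_fst

lemma cylinder_total (X Y : BoundedNComplex A N) :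
    fromCylinder X Y ≫ inclCylinder X Y + cylinderToHull X Y ≫ hullToCylinder X Y = 𝟙 _ :=
  ObjectProperty.hom_ext _ biprod.total

lemma isIso_map_fromCylinder (X Y : BoundedNComplex A N) :
    IsIso ((toHomotopyCat A N).map (fromCylinder X Y)) := by
  refine ⟨(toHomotopyCat A N).map (inclCylinder X Y), ?_, ?_⟩
  · rw [← Functor.map_comp, ← CategoryTheory.Functor.map_id]
    refine (Quotient.functor_map_eq_iff _ _ _).2 ?_
    have e : fromCylinder X Y ≫ inclCylinder X Y - 𝟙 _ =
        -(cylinderToHull X Y ≫ 𝟙 _ ≫ hullToCylinder X Y) := by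
      rw [Category.id_comp, ← cylinder_total]
      abel
    change NullHomotopic (_ - _)
    rw [e]
    exact (((nullHomotopic_id_hullComplex X).postcomp _).precomp _).neg
  · rw [← Functor.map_comp, inclCylinder_fromCylinder, CategoryTheory.Functor.map_id]

lemma quasiIso_toCylinder {X Y : BoundedNComplex A N} {f : X ⟶ Y} (hf : QuasiIso N f.hom) :
    QuasiIso N (toCylinder f).hom := by
  have hfst : ∀ n, (toCylinder f).hom.app n ≫ (fromCylinder X Y).hom.app n = f.hom.app n :=
    fun n => congrArg (fun φ : X ⟶ Y => φ.hom.app n) (toCylinder_fromCylinder f)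
  constructor
  · intro a b c hab hbc hc T y hy
    obtain ⟨T', π, _, x, z, hx, hz⟩ := hf.surj a b c hab hbc hc (y ≫ (fromCylinder X Y).hom.app b)
      (by rw [Category.assoc, ← d_naturality, reassoc_of% hy, zero_comp])
    -- the component in the hull is a cycle, hence a boundary
    obtain ⟨w, hw⟩ := (nullHomotopic_id_hullComplex X).exists_eq_comp_d a b c hab.le hbc.le hc
      ((π ≫ y - x ≫ (toCylinder f).hom.app b) ≫ (cylinderToHull X Y).hom.app b) (by
        rw [Category.assoc, ← d_naturality, Preadditive.sub_comp_assoc, Category.assoc,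
          hy, Category.assoc, ← d_naturality, reassoc_of% hx]
        simp)
    replace hw := hw.symm.trans (Category.comp_id _)
    refine ⟨T', π, ‹_›, x, z ≫ (inclCylinder X Y).hom.app a + w ≫ (hullToCylinder X Y).hom.app a,
      hx, ?_⟩
    have htot := congrArg (fun φ : cylinder X Y ⟶ cylinder X Y =>
      (π ≫ y - x ≫ (toCylinder f).hom.app b) ≫ φ.hom.app b) (cylinder_total X Y)
    replace htot : ((π ≫ y - x ≫ (toCylinder f).hom.app b) ≫ (fromCylinder X Y).hom.app b) ≫
        (inclCylinder X Y).hom.app b + ((π ≫ y - x ≫ (toCylinder f).hom.app b) ≫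
        (cylinderToHull X Y).hom.app b) ≫ (hullToCylinder X Y).hom.app b =
        π ≫ y - x ≫ (toCylinder f).hom.app b := by
      rw [Category.assoc, Category.assoc, ← Preadditive.comp_add]
      exact htot.trans (Category.comp_id _)
    rw [← hw, Preadditive.sub_comp, Category.assoc, hz, Category.assoc, hfst, add_sub_cancel_left,
      Category.assoc, Category.assoc, d_naturality, d_naturality] at htot
    rw [Preadditive.add_comp, Category.assoc, Category.assoc, htot]
    abel
  · intro a b c hab hbc hc T x z hx hz
    refine hf.inj a b c hab hbc hc x (z ≫ (fromCylinder X Y).hom.app a) hx ?_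
    rw [← hfst, reassoc_of% hz, Category.assoc, d_naturality]

/-- The degreewise cokernel of a morphism of sequences. -/
def coker {K L : ℤ ⥤ A} (f : K ⟶ L) : ℤ ⥤ A where
  obj n := cokernel (f.app n)
  map {m n} a := cokernel.map _ _ (K.map a) (L.map a) (f.naturality a).symm

/-- The projection to the degreewise cokernel. -/
def cokerπ {K L : ℤ ⥤ A} (f : K ⟶ L) : L ⟶ coker f where
  app n := cokernel.π (f.app n)
  naturality _ _ _ := (cokernel.π_desc _ _ _).symm

instance {K L : ℤ ⥤ A} (f : K ⟶ L) (n : ℤ) : Epi ((cokerπ f).app n) :=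
  inferInstanceAs (Epi (cokernel.π (f.app n)))

lemma isNComplex_coker {K L : ℤ ⥤ A} (f : K ⟶ L) (hL : isNComplex A N L) :
    isNComplex A N (coker f) := by
  intro n
  rw [← cancel_epi ((cokerπ f).app n), ← NatTrans.naturality, hL n, zero_comp, comp_zero]

lemma isBounded_coker {K L : ℤ ⥤ A} (f : K ⟶ L) (hL : isBounded A L) :
    isBounded A (coker f) := by
  obtain ⟨b, hb⟩ := hL
  refine ⟨b, fun n hn => ?_⟩
  rw [IsZero.iff_id_eq_zero, ← cancel_epi ((cokerπ f).app n)]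
  exact (hb n hn).eq_of_src _ _

/-- The sequence `X ⟶ cylinder ⟶ cone` of a morphism `X ⟶ Y`. -/
def cylinderSequence {X Y : BoundedNComplex A N} (f : X ⟶ Y) :
    ShortComplex (BoundedNComplex A N) where
  X₁ := X
  X₂ := cylinder X Y
  X₃ := ⟨coker (toCylinder f).hom, isNComplex_coker _ (cylinder X Y).property.1,
    isBounded_coker _ (cylinder X Y).property.2⟩
  f := toCylinder f
  g := ObjectProperty.homMk (cokerπ (toCylinder f).hom)
  zero := by
    ext n
    exact cokernel.condition _

lemma chainwiseSplit_cylinderSequence (hN : 1 ≤ N) {X Y : BoundedNComplex A N} (f : X ⟶ Y) :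
    ChainwiseSplit (cylinderSequence f) := by
  intro n
  refine ⟨ShortComplex.Splitting.ofExactOfRetraction _
    (ShortComplex.exact_cokernel ((toCylinder f).hom.app n))
    ((cylinderToHull X Y).hom.app n ≫ hullπ N X.obj n n ⟨le_rfl, by lia⟩) ?_
    (inferInstanceAs (Epi ((cokerπ (toCylinder f).hom).app n)))⟩
  have : (toCylinder f).hom.app n ≫ (cylinderToHull X Y).hom.app n =
      (toHull X.obj X.property.1).app n :=
    congr_app (biprod.lift_snd f.hom (toHull X.obj X.property.1)) n
  exact (Category.assoc _ _ _).symm.trans ((congrArg (· ≫ _) this).trans (toHull_π _ n (by lia)))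

lemma isIso_map_toDerivedCat_of_chainwiseSplit {S : ShortComplex (BoundedNComplex A N)}
    (hS : ChainwiseSplit S) (hZ : Acyclic S.X₃) : IsIso ((toDerivedCat A N).map S.f) :=
  (acyclicCone A N).Q_inverts _ ⟨S, hS, hZ, ⟨Iso.refl _⟩⟩

lemma QuasiIso.isIso_map_toDerivedCat (hN : 1 ≤ N) {X Y : BoundedNComplex A N} {f : X ⟶ Y}
    (hf : QuasiIso N f.hom) : IsIso ((toDerivedCat A N).map f) := by
  have hS := chainwiseSplit_cylinderSequence hN f
  have h₁ : IsIso ((toDerivedCat A N).map (toCylinder f)) :=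
    isIso_map_toDerivedCat_of_chainwiseSplit hS (hS.acyclic (quasiIso_toCylinder hf))
  have := isIso_map_fromCylinder X Y
  have h₂ : IsIso ((toDerivedCat A N).map (fromCylinder X Y)) :=
    inferInstanceAs (IsIso ((acyclicCone A N).Q.map ((toHomotopyCat A N).map (fromCylinder X Y))))
  rw [← toCylinder_fromCylinder f, Functor.map_comp]
  infer_instance

/-- A functor on the homotopy category whose restriction to complexes inverts quasi-isomorphisms
inverts all morphisms with acyclic cone. -/
lemma isInvertedBy_acyclicCone {E : Type*} [Category* E] (F : HomotopyCat A N ⥤ E)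
    (hF : ∀ ⦃X Y : BoundedNComplex A N⦄ (f : X ⟶ Y), QuasiIso N f.hom →
      IsIso (F.map ((toHomotopyCat A N).map f))) : (acyclicCone A N).IsInvertedBy F := by
  rintro X Y f ⟨S, hS, hZ, ⟨e⟩⟩
  exact ((MorphismProperty.isomorphisms E).arrow_mk_iso_iff (F.mapArrow.mapIso e)).2
    (hF S.f (hS.quasiIso hZ))

end Cylinder

/-! ### Truncations -/

section Truncation

variable {A : Type u} [Category.{v} A] [Abelian A]

/-- The truncation of a sequence: the subobject `ker (K^i ⟶ K^{max i N})` in degree `i`. For an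
`N`-complex it is `K^i` in degrees `i ≤ 0`, the kernel of `K^i ⟶ K^N` in degrees `1 ≤ i < N`, and
zero in degrees `i ≥ N`. -/
def trunc (N : ℕ) (K : ℤ ⥤ A) : ℤ ⥤ A where
  obj i := kernel (d K i (max i N))
  map {m n} a := kernel.lift _ (kernel.ι _ ≫ K.map a) (by
    have := leOfHom a
    rw [map_eq_d, Category.assoc, d_comp, ← d_comp K m (max m N) (max n N) (by lia) (by lia),
      kernel.condition_assoc, zero_comp])
  map_id n := by
    rw [← cancel_mono (kernel.ι _), kernel.lift_ι, CategoryTheory.Functor.map_id,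
      Category.comp_id, Category.id_comp]
  map_comp a b := by
    rw [← cancel_mono (kernel.ι _)]
    simp

/-- The inclusion of the truncation. -/
def truncι (N : ℕ) (K : ℤ ⥤ A) : trunc N K ⟶ K where
  app _ := kernel.ι _
  naturality _ _ _ := kernel.lift_ι _ _ _

variable {N : ℕ} {K L : ℤ ⥤ A}

instance (i : ℤ) : Mono ((truncι N K).app i) := inferInstanceAs (Mono (kernel.ι _))

lemma truncι_d (i c : ℤ) (hi : i ≤ c) (h : N ≤ c) : (truncι N K).app i ≫ d K i c = 0 := by
  rw [← d_comp K i (max i N) c (by lia) (by lia)]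
  exact (kernel.condition_assoc (d K i (max i N)) _).trans zero_comp

lemma exists_truncLift {i c : ℤ} (hi : i ≤ c) (h : c ≤ max i N) {T : A} (x : T ⟶ K.obj i)
    (hx : x ≫ d K i c = 0) : ∃ y : T ⟶ (trunc N K).obj i, y ≫ (truncι N K).app i = x :=
  ⟨kernel.lift _ x (by rw [← d_comp K i c _ hi h, reassoc_of% hx, zero_comp]),
    kernel.lift_ι _ _ _⟩

lemma isZero_trunc {i : ℤ} (h : N ≤ i) : IsZero ((trunc N K).obj i) := by
  rw [IsZero.iff_id_eq_zero, ← cancel_mono ((truncι N K).app i)]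
  simpa using truncι_d (N := N) (K := K) i i le_rfl h

/-- The morphism induced on truncations, in a given degree. -/
def truncMapApp (N : ℕ) (f : K ⟶ L) (i : ℤ) : (trunc N K).obj i ⟶ (trunc N L).obj i :=
  kernel.map _ _ (f.app i) (f.app _) (d_naturality _ _ _ _)

lemma truncMapApp_ι (f : K ⟶ L) (i : ℤ) :
    truncMapApp N f i ≫ (truncι N L).app i = (truncι N K).app i ≫ f.app i :=
  kernel.lift_ι _ _ _

/-- The morphism induced on truncations. -/
def truncMap (N : ℕ) (f : K ⟶ L) : trunc N K ⟶ trunc N L where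
  app := truncMapApp N f
  naturality m n a := by
    rw [← cancel_mono ((truncι N L).app n), Category.assoc, Category.assoc, truncMapApp_ι,
      NatTrans.naturality_assoc, NatTrans.naturality, NatTrans.naturality, reassoc_of% truncMapApp_ι f m]

@[simp]
lemma truncMap_ι_app (f : K ⟶ L) (i : ℤ) : (truncMap N f).app i ≫ (truncι N L).app i =
    (truncι N K).app i ≫ f.app i := truncMapApp_ι f i

lemma truncMap_ι (f : K ⟶ L) : truncMap N f ≫ truncι N L = truncι N K ≫ f := by
  ext i
  exact truncMap_ι_app f i

instance : Mono (truncι N K) := NatTrans.mono_of_mono_app _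

lemma isNComplex_trunc (hK : isNComplex A N K) : isNComplex A N (trunc N K) := by
  intro n
  rw [← cancel_mono ((truncι N K).app _), NatTrans.naturality, hK n, comp_zero, zero_comp]

lemma isBounded_trunc (hK : isBounded A K) : isBounded A (trunc N K) := by
  obtain ⟨b, hb⟩ := hK
  refine ⟨b, fun n hn => ?_⟩
  rw [IsZero.iff_id_eq_zero, ← cancel_mono ((truncι N K).app n)]
  exact (hb n hn).eq_of_tgt _ _

variable (A N) in
/-- The truncation functor on bounded `N`-complexes. -/
def truncFunctor : BoundedNComplex A N ⥤ BoundedNComplex A N where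
  obj X := ⟨trunc N X.obj, isNComplex_trunc X.property.1, isBounded_trunc X.property.2⟩
  map f := ObjectProperty.homMk (truncMap N f.hom)
  map_id X := ObjectProperty.hom_ext _ (by
    rw [← cancel_mono (truncι N X.obj)]
    exact (truncMap_ι _).trans ((Category.comp_id _).trans (Category.id_comp _).symm))
  map_comp {X Y Z} f g := ObjectProperty.hom_ext _ (by
    rw [← cancel_mono (truncι N Z.obj)]
    change truncMap N (f.hom ≫ g.hom) ≫ _ = (truncMap N f.hom ≫ truncMap N g.hom) ≫ _
    rw [Category.assoc, truncMap_ι, truncMap_ι, ← Category.assoc (truncMap N f.hom),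
      truncMap_ι, Category.assoc])

variable (A N) in
/-- The inclusion of the truncation, as a natural transformation. -/
def truncFunctorι : truncFunctor A N ⟶ 𝟭 _ where
  app X := ObjectProperty.homMk (truncι N X.obj)
  naturality _ _ f := ObjectProperty.hom_ext _ (truncMap_ι f.hom)

/-- A homotopy restricts to the truncations: a component in degree `m < N` ends in a degree
`m - N + 1 ≤ 0`, where the truncation is the whole complex. -/
lemma NullHomotopic.trunc {X Y : BoundedNComplex A N} {f : X ⟶ Y} (hf : NullHomotopic f) :
    NullHomotopic ((truncFunctor A N).map f) := by
  obtain ⟨h, hh⟩ := (nullHomotopic_iff f).1 hf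
  have key : ∀ m : ℤ, ∃ k : (NCx.trunc N X.obj).obj m ⟶ (NCx.trunc N Y.obj).obj (m - N + 1),
      k ≫ (truncι N Y.obj).app _ = (truncι N X.obj).app m ≫ h m := by
    intro m
    by_cases hm : m < N
    · refine exists_truncLift (c := m + 1) (by lia) (by lia) _ ?_
      rw [d_eq_zero Y.property.1 _ _ _ (by lia), comp_zero]
    · exact ⟨0, (isZero_trunc (by lia)).eq_of_src _ _⟩
  choose k hk using key
  refine (nullHomotopic_iff _).2 ⟨k, fun i => ?_⟩
  change (truncMap N f.hom).app i = ∑ j : Fin N, d (NCx.trunc N X.obj) _ _ _ ≫ k _ ≫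
    d (NCx.trunc N Y.obj) _ _ _
  rw [← cancel_mono ((truncι N Y.obj).app i), truncMap_ι_app, hh, Preadditive.comp_sum,
    Preadditive.sum_comp]
  refine Finset.sum_congr rfl fun j _ => ?_
  rw [Category.assoc, Category.assoc, d_naturality, reassoc_of% hk, ← d_naturality_assoc]

/-- Truncation preserves quasi-isomorphisms. In degrees `0 < a < b < N` the homology of the
truncation is the cokernel of the map between the homologies of `K^0 ⟶ K^a ⟶ K^N` and
`K^0 ⟶ K^b ⟶ K^N`; the other homologies are zero or agree with those of the complex itself. -/
lemma QuasiIso.trunc {f : K ⟶ L} (hf : QuasiIso N f) (hK : isNComplex A N K)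
    (hL : isNComplex A N L) : QuasiIso N (truncMap N f) := by
  constructor
  · intro a b c hab hbc hc T y hy
    by_cases hbN : N ≤ b
    · exact ⟨T, 𝟙 T, inferInstance, 0, 0, by simp, (isZero_trunc hbN).eq_of_tgt _ _⟩
    -- if `a > 0`, every cycle is a cycle for `K^0 ⟶ K^b ⟶ K^N`; otherwise `c ≤ N`
    obtain ⟨c', hbc', hcN, hy', hc'⟩ : ∃ (c' : ℤ) (h : b < c') (_ : c' ≤ N),
        (y ≫ (truncι N L).app b) ≫ d L b c' = 0 ∧ (c' = c ∨ (c' = N ∧ 0 < a)) := by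
      by_cases ha : a ≤ 0
      · refine ⟨c, hbc, by lia, ?_, Or.inl rfl⟩
        rw [Category.assoc, ← d_naturality, reassoc_of% hy, zero_comp]
      · refine ⟨N, by lia, le_rfl, ?_, Or.inr ⟨rfl, by lia⟩⟩
        rw [Category.assoc, truncι_d _ _ (by lia) le_rfl, comp_zero]
    obtain ⟨T', π, hπ, x, z, hx, hz⟩ := hf.surj (c' - N) b c' (by lia) hbc' (by lia) _ hy'
    obtain ⟨x, rfl⟩ := exists_truncLift (N := N) hbc'.le (by lia) x hx
    obtain ⟨z', hz'⟩ := exists_truncLift (N := N) (K := L) (i := a) (c := c') (by lia) (by lia)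
      (z ≫ d L (c' - N) a) (by
        rw [Category.assoc, d_comp, d_eq_zero hL _ _ _ (by lia), comp_zero])
    refine ⟨T', π, hπ, x, z', ?_, ?_⟩
    · rcases hc' with rfl | ⟨rfl, ha⟩
      · rw [← cancel_mono ((truncι N K).app _), Category.assoc, d_naturality, zero_comp,
          ← Category.assoc, hx]
      · exact (isZero_trunc (by lia)).eq_of_tgt _ _
    · rw [← cancel_mono ((truncι N L).app b), Preadditive.add_comp, Category.assoc, hz,
        Category.assoc, Category.assoc, Category.assoc, truncMap_ι_app, d_naturality,
        reassoc_of% hz', d_comp]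
  · intro a b c hab hbc hc T x z hx hxz
    by_cases hbN : N ≤ b
    · exact ⟨T, 𝟙 T, inferInstance, 0, (isZero_trunc hbN).eq_of_tgt _ _⟩
    have hxz' : (x ≫ (truncι N K).app b) ≫ f.app b = (z ≫ (truncι N L).app a) ≫ d L a b := by
      rw [Category.assoc, ← truncMap_ι_app, reassoc_of% hxz, d_naturality, Category.assoc]
    suffices ∃ (T' : A) (π : T' ⟶ T) (_ : Epi π) (w : T' ⟶ K.obj a), w ≫ d K a (min c N) = 0 ∧
        π ≫ x ≫ (truncι N K).app b = w ≫ d K a b by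
      obtain ⟨T', π, hπ, w, hw, h⟩ := this
      obtain ⟨w, rfl⟩ := exists_truncLift (N := N) (by lia) (by lia) w hw
      refine ⟨T', π, hπ, w, ?_⟩
      rw [← cancel_mono ((truncι N K).app b), Category.assoc, Category.assoc, h, d_naturality,
        Category.assoc]
    by_cases ha : a ≤ 0
    · obtain ⟨T', π, hπ, w, hw⟩ := hf.inj a b c hab hbc hc _ _ (by
        rw [Category.assoc, ← d_naturality, reassoc_of% hx, zero_comp]) hxz'
      have hK' : d K a (min c N) = 0 := d_eq_zero hK _ _ _ (by lia)
      exact ⟨T', π, hπ, w, by rw [hK', comp_zero], hw⟩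
    · -- replace the class of `z` in the homology at `a` by that of an element `p` of `K^a`; then
      -- `x` and the image of `p` differ by a boundary from degree `0`
      obtain ⟨T', π, hπ, p, q, hp, hpq⟩ := hf.surj 0 a N (by lia) (by lia) (by lia)
        (z ≫ (truncι N L).app a) (by rw [Category.assoc, truncι_d _ _ (by lia) le_rfl, comp_zero])
      obtain ⟨T'', π', hπ', w, hw⟩ := hf.inj 0 b N (by lia) (by lia) (by lia)
        (π ≫ x ≫ (truncι N K).app b - p ≫ d K a b) q (by
          rw [Preadditive.sub_comp, Category.assoc, Category.assoc, truncι_d _ _ (by lia) le_rfl,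
            Category.assoc, d_comp, hp, comp_zero, comp_zero, sub_zero]) (by
          rw [Preadditive.sub_comp, Category.assoc, hxz', ← Category.assoc, ← Category.assoc,
            Category.assoc π, hpq, Category.assoc, d_naturality]
          simp)
      refine ⟨T'', π' ≫ π, epi_comp _ _, π' ≫ p + w ≫ d K 0 a, ?_, ?_⟩
      · rw [Preadditive.add_comp, Category.assoc, Category.assoc, d_comp,
          d_eq_zero hK 0 _ _ (by lia), comp_zero, add_zero,
          ← d_comp K a N _ (by lia) (by lia), reassoc_of% hp, zero_comp, comp_zero]
      · rw [Preadditive.add_comp, Category.assoc, Category.assoc w, d_comp, ← hw]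
        simp

/-- The quotient of a sequence which is `coker (K^{min i 0} ⟶ K^i)` in degree `i`. It is zero in
degrees `i ≤ 0`. -/
def quo (K : ℤ ⥤ A) : ℤ ⥤ A where
  obj i := cokernel (d K (min i 0) i)
  map {m n} a := cokernel.desc _ (K.map a ≫ cokernel.π _) (by
    have := leOfHom a
    rw [map_eq_d, d_comp_assoc, ← d_comp K (min m 0) (min n 0) n (by lia) (by lia), Category.assoc,
      cokernel.condition, comp_zero])
  map_id n := by
    rw [← cancel_epi (cokernel.π _), cokernel.π_desc, CategoryTheory.Functor.map_id,
      Category.comp_id, Category.id_comp]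
  map_comp a b := by
    rw [← cancel_epi (cokernel.π _)]
    simp

/-- The projection to the quotient. -/
def quoπ (K : ℤ ⥤ A) : K ⟶ quo K where
  app _ := cokernel.π _
  naturality _ _ _ := (cokernel.π_desc _ _ _).symm

instance (i : ℤ) : Epi ((quoπ K).app i) :=
  inferInstanceAs (Epi (cokernel.π (d K (min i 0) i)))

instance : Epi (quoπ K) := NatTrans.epi_of_epi_app _

lemma d_quoπ (c i : ℤ) (hi : c ≤ i) (h : c ≤ 0) : d K c i ≫ (quoπ K).app i = 0 := by
  rw [← d_comp K c (min i 0) i (by lia) (by lia), Category.assoc]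
  exact (congrArg (_ ≫ ·) (cokernel.condition _)).trans comp_zero

lemma exists_of_comp_quoπ_eq_zero {c i : ℤ} (hi : c ≤ i) (h : min i 0 ≤ c) {T : A}
    (x : T ⟶ K.obj i) (hx : x ≫ (quoπ K).app i = 0) :
    ∃ (T' : A) (π : T' ⟶ T) (_ : Epi π) (y : T' ⟶ K.obj c), π ≫ x = y ≫ d K c i := by
  obtain ⟨T', π, hπ, y, hy⟩ :=
    (ShortComplex.exact_cokernel (d K (min i 0) i)).exact_up_to_refinements x hx
  refine ⟨T', π, hπ, y ≫ d K (min i 0) c, ?_⟩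
  rw [Category.assoc, d_comp]
  exact hy

lemma isZero_quo {i : ℤ} (h : i ≤ 0) : IsZero ((quo K).obj i) := by
  rw [IsZero.iff_id_eq_zero, ← cancel_epi ((quoπ K).app i)]
  simpa using d_quoπ (K := K) i i le_rfl h

lemma isZero_quo_of_isZero {i : ℤ} (h : IsZero (K.obj i)) : IsZero ((quo K).obj i) := by
  rw [IsZero.iff_id_eq_zero, ← cancel_epi ((quoπ K).app i)]
  exact h.eq_of_src _ _

/-- The morphism induced on quotients, in a given degree. -/
def quoMapApp (f : K ⟶ L) (i : ℤ) : (quo K).obj i ⟶ (quo L).obj i :=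
  cokernel.map _ _ (f.app _) (f.app i) (d_naturality _ _ _ _)

lemma quoπ_mapApp (f : K ⟶ L) (i : ℤ) :
    (quoπ K).app i ≫ quoMapApp f i = f.app i ≫ (quoπ L).app i :=
  cokernel.π_desc _ _ _

/-- The morphism induced on quotients. -/
def quoMap (f : K ⟶ L) : quo K ⟶ quo L where
  app := quoMapApp f
  naturality m n a := by
    rw [← cancel_epi ((quoπ K).app m), ← NatTrans.naturality_assoc, quoπ_mapApp,
      reassoc_of% quoπ_mapApp f m, NatTrans.naturality_assoc, NatTrans.naturality]

@[simp]
lemma quoπ_map_app (f : K ⟶ L) (i : ℤ) :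
    (quoπ K).app i ≫ (quoMap f).app i = f.app i ≫ (quoπ L).app i := quoπ_mapApp f i

lemma quoπ_map (f : K ⟶ L) : quoπ K ≫ quoMap f = f ≫ quoπ L := by
  ext i
  exact quoπ_map_app f i

/-- The quotient of the truncation of `K`: it is concentrated in degrees `1 ≤ i < N`, where it is
the homology of `K^0 ⟶ K^i ⟶ K^N`. -/
abbrev core (N : ℕ) (K : ℤ ⥤ A) : ℤ ⥤ A := quo (NCx.trunc N K)

/-- The morphism induced on cores. -/
abbrev coreMap (N : ℕ) (f : K ⟶ L) : core N K ⟶ core N L := quoMap (truncMap N f)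

lemma isZero_core (i : ℤ) (h : ¬ (1 ≤ i ∧ i < N)) : IsZero ((core N K).obj i) := by
  by_cases hi : i ≤ 0
  · exact isZero_quo hi
  · exact isZero_quo_of_isZero (isZero_trunc (by lia))

variable (A N) in
/-- The core as a functor. -/
def coreFunctor : BoundedNComplex A N ⥤ (ℤ ⥤ A) where
  obj X := core N X.obj
  map f := coreMap N f.hom
  map_id X := by
    rw [← cancel_epi (quoπ _), quoπ_map]
    have : truncMap N (𝟙 X : X ⟶ X).hom = 𝟙 _ :=
      congrArg (·.hom) ((truncFunctor A N).map_id X)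
    rw [this, Category.id_comp, Category.comp_id]
  map_comp f g := by
    rw [← cancel_epi (quoπ _), quoπ_map, ← Category.assoc, quoπ_map, Category.assoc, quoπ_map]
    have : truncMap N (f ≫ g).hom = truncMap N f.hom ≫ truncMap N g.hom :=
      congrArg (·.hom) ((truncFunctor A N).map_comp f g)
    rw [this, Category.assoc]

lemma coreMap_eq_zero {X Y : BoundedNComplex A N} {f : X ⟶ Y} (hf : NullHomotopic f) :
    coreMap N f.hom = 0 := by
  ext i
  by_cases hi : 1 ≤ i ∧ i < N
  · obtain ⟨z, hz⟩ := hf.exists_eq_comp_d 0 i N (by lia) (by lia) (by lia)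
      ((truncι N X.obj).app i) (truncι_d _ _ (by lia) le_rfl)
    obtain ⟨z, rfl⟩ := exists_truncLift (N := N) (K := Y.obj) (c := N) (by lia) (by lia) z (by
      rw [d_eq_zero Y.property.1 _ _ _ (by lia), comp_zero])
    have e : (truncMap N f.hom).app i = z ≫ d (NCx.trunc N Y.obj) 0 i := by
      rw [← cancel_mono ((truncι N Y.obj).app i), truncMap_ι_app, hz, Category.assoc,
        Category.assoc, d_naturality]
    rw [← cancel_epi ((quoπ _).app i), quoπ_map_app, e, Category.assoc, d_quoπ _ _ (by lia) le_rfl,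
      comp_zero]
    exact comp_zero.symm
  · exact (isZero_core i hi).eq_of_src _ _

/-- A quasi-isomorphism induces an isomorphism on cores, their components being homology objects. -/
lemma QuasiIso.isIso_coreMap {f : K ⟶ L} (hf : QuasiIso N f) (hK : isNComplex A N K)
    (hL : isNComplex A N L) : IsIso (coreMap N f) := by
  rw [NatTrans.isIso_iff_isIso_app]
  intro i
  by_cases hi : 1 ≤ i ∧ i < N
  · have : Epi ((coreMap N f).app i) := by
      rw [epi_iff_surjective_up_to_refinements]
      intro T y
      obtain ⟨T', π, _, y, hy⟩ := surjective_up_to_refinements_of_epi ((quoπ _).app i) y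
      obtain ⟨T'', π', _, x, z, hx, hz⟩ := hf.surj 0 i N (by lia) (by lia) (by lia)
        (y ≫ (truncι N L).app i) (by rw [Category.assoc, truncι_d _ _ (by lia) le_rfl, comp_zero])
      obtain ⟨x, rfl⟩ := exists_truncLift (N := N) (by lia) (by lia) x hx
      obtain ⟨z, rfl⟩ := exists_truncLift (N := N) (K := L) (c := N) (by lia) (by lia) z (by
        rw [d_eq_zero hL _ _ _ (by lia), comp_zero])
      have e : π' ≫ y = x ≫ (truncMap N f).app i + z ≫ d (NCx.trunc N L) 0 i := by
        rw [← cancel_mono ((truncι N L).app i), Category.assoc, hz, Preadditive.add_comp,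
          Category.assoc, Category.assoc, Category.assoc, Category.assoc, truncMap_ι_app,
          d_naturality]
      refine ⟨T'', π' ≫ π, epi_comp _ _, x ≫ (quoπ _).app i, ?_⟩
      rw [Category.assoc, hy, reassoc_of% e, Category.assoc, quoπ_map_app, Preadditive.add_comp,
        Category.assoc, Category.assoc, d_quoπ _ _ (by lia) le_rfl, comp_zero, add_zero]
    have : Mono ((coreMap N f).app i) := by
      refine Preadditive.mono_of_cancel_zero _ fun {T} x hx => ?_
      obtain ⟨T', π, _, x', hx'⟩ := surjective_up_to_refinements_of_epi ((quoπ _).app i) x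
      obtain ⟨T₂, π₂, _, z, hz⟩ := exists_of_comp_quoπ_eq_zero (c := 0) (by lia) (by lia)
        (x' ≫ (truncMap N f).app i) (by
          rw [Category.assoc, ← quoπ_map_app, ← Category.assoc, ← hx', Category.assoc, hx,
            comp_zero])
      obtain ⟨T₃, π₃, _, w, hw⟩ := hf.inj 0 i N (by lia) (by lia) (by lia)
        (π₂ ≫ x' ≫ (truncι N K).app i) (z ≫ (truncι N L).app 0) (by
          rw [Category.assoc, Category.assoc, truncι_d _ _ (by lia) le_rfl, comp_zero, comp_zero]) (by
          rw [Category.assoc, Category.assoc, ← truncMap_ι_app, reassoc_of% hz, d_naturality,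
            Category.assoc])
      obtain ⟨w, rfl⟩ := exists_truncLift (N := N) (K := K) (c := N) (by lia) (by lia) w (by
        rw [d_eq_zero hK _ _ _ (by lia), comp_zero])
      have e : π₃ ≫ π₂ ≫ x' = w ≫ d (NCx.trunc N K) 0 i := by
        rw [← cancel_mono ((truncι N K).app i), Category.assoc, Category.assoc, hw, Category.assoc,
          Category.assoc, d_naturality]
      rw [← cancel_epi π, ← cancel_epi π₂, ← cancel_epi π₃, hx', reassoc_of% e,
        d_quoπ _ _ (by lia) le_rfl]
      simp
    exact isIso_of_mono_of_epi _
  · exact (isZero_core i hi).isIso (isZero_core i hi) _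

end Truncation

/-! ### Sequences concentrated in degrees `1, …, N - 1` -/

section Restriction

variable {A : Type u} [Category.{v} A] {N : ℕ}

/-- A sequence is concentrated in the degrees `1, …, N - 1`. -/
def IsConcentrated (N : ℕ) (M : ℤ ⥤ A) : Prop :=
  ∀ n : ℤ, ¬ (1 ≤ n ∧ n ≤ (N : ℤ) - 1) → IsZero (M.obj n)

variable (A) in
/-- The restriction of a sequence to the degrees `1, …, N - 1`. -/
abbrev restrict (N : ℕ) : (ℤ ⥤ A) ⥤ ComposableArrows A (N - 2) :=
  (Functor.whiskeringLeft _ _ _).obj (degreeInclusion N)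

lemma IsConcentrated.hom_ext {M M' : ℤ ⥤ A} (hM : IsConcentrated N M) {f g : M ⟶ M'}
    (h : (restrict A N).map f = (restrict A N).map g) : f = g := by
  ext n
  by_cases hn : 1 ≤ n ∧ n ≤ (N : ℤ) - 1
  · obtain ⟨i, rfl⟩ : ∃ i : Fin (N - 2 + 1), n = ((i : ℕ) : ℤ) + 1 :=
      ⟨⟨(n - 1).toNat, by lia⟩, by dsimp only; lia⟩
    exact congr_app h i
  · exact (hM n hn).eq_of_src _ _

lemma map_comp_eqToHom {k : ℕ} (X : ComposableArrows A k) {p p' q q' : Fin (k + 1)}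
    (hp : p = p') (hq : q = q') (f : p ⟶ q) (f' : p' ⟶ q') :
    X.map f ≫ eqToHom (congrArg X.obj hq) = eqToHom (congrArg X.obj hp) ≫ X.map f' := by
  subst hp hq
  simp [Subsingleton.elim f f']

/-- The identification of `M^n` with the term of the restriction of `M` that has index `n - 1`. -/
def toRestrict (N : ℕ) (M : ℤ ⥤ A) (n : ℤ) (h : 1 ≤ n ∧ n ≤ ((N - 2 : ℕ) : ℤ) + 1) :
    M.obj n ⟶ ((restrict A N).obj M).obj ⟨(n - 1).toNat, by lia⟩ :=
  d M n ((n - 1).toNat + 1)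

instance (M : ℤ ⥤ A) (n : ℤ) (h : 1 ≤ n ∧ n ≤ ((N - 2 : ℕ) : ℤ) + 1) :
    IsIso (toRestrict N M n h) :=
  ⟨d M ((n - 1).toNat + 1) n (by lia), (d_comp _ _ _ _ _ _).trans (d_self _ _ _),
    (d_comp _ _ _ _ _ _).trans (d_self _ _ _)⟩

lemma d_toRestrict (M : ℤ ⥤ A) (m n : ℤ) (hm : 1 ≤ m ∧ m ≤ ((N - 2 : ℕ) : ℤ) + 1)
    (hn : 1 ≤ n ∧ n ≤ ((N - 2 : ℕ) : ℤ) + 1) (hmn : m ≤ n) :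
    d M m n hmn ≫ toRestrict N M n hn = toRestrict N M m hm ≫
      ((restrict A N).obj M).map (homOfLE (show (m - 1).toNat ≤ (n - 1).toNat by lia)) :=
  (d_comp M m n ((n - 1).toNat + 1) hmn (by lia)).trans
    (d_comp M m ((m - 1).toNat + 1) ((n - 1).toNat + 1) (by lia) (by lia)).symm

lemma app_toRestrict {M M' : ℤ ⥤ A} (f : M ⟶ M') (n : ℤ)
    (h : 1 ≤ n ∧ n ≤ ((N - 2 : ℕ) : ℤ) + 1) :
    f.app n ≫ toRestrict N M' n h = toRestrict N M n h ≫ ((restrict A N).map f).app _ :=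
  (d_naturality f _ _ _).symm

end Restriction

section Extension

variable {A : Type u} [Category.{v} A] [Abelian A] {N : ℕ}

lemma isConcentrated_core (K : ℤ ⥤ A) : IsConcentrated N (core N K) :=
  fun n hn => isZero_core n (by lia)

lemma isConcentrated_extFunctor (hN : 2 ≤ N) (X : ComposableArrows A (N - 2)) :
    IsConcentrated N ((extFunctor A (N - 2)).obj X) :=
  fun n hn => isZero_extObj X n (by lia)

lemma extObj_succ {k : ℕ} (X : ComposableArrows A k) (i : Fin (k + 1)) :
    extObj X ((i : ℕ) + 1) = X.obj i := by
  have := i.isLt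
  rw [extObj_eq X _ ⟨by lia, by lia⟩]
  congr 1
  exact Fin.ext (by dsimp only; lia)

lemma extMap_succ {k : ℕ} (X : ComposableArrows A k) {i j : Fin (k + 1)} (f : i ⟶ j)
    (h : ((i : ℕ) : ℤ) + 1 ≤ (j : ℕ) + 1) :
    extMap X ((i : ℕ) + 1) ((j : ℕ) + 1) h ≫ eqToHom (extObj_succ X j) =
      eqToHom (extObj_succ X i) ≫ X.map f := by
  have hj : ((j : ℕ) : ℤ) + 1 ≤ k + 1 := by
    exact_mod_cast Nat.add_le_add_right j.is_le 1
  rw [extMap, dif_pos ⟨by lia, hj⟩, Category.assoc, Category.assoc, eqToHom_trans,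
    map_comp_eqToHom X (Fin.ext (by dsimp only; lia)) (Fin.ext (by dsimp only; lia)) _ f,
    eqToHom_trans_assoc]

lemma extHomApp_succ {k : ℕ} {X Y : ComposableArrows A k} (f : X ⟶ Y) (i : Fin (k + 1)) :
    extHomApp f ((i : ℕ) + 1) ≫ eqToHom (extObj_succ Y i) =
      eqToHom (extObj_succ X i) ≫ f.app i := by
  have := i.isLt
  have key : ∀ (j : Fin (k + 1)) (h : j = i), f.app j ≫ eqToHom (congrArg Y.obj h) =
      eqToHom (congrArg X.obj h) ≫ f.app i := by
    rintro _ rfl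
    simp
  rw [extHomApp, dif_pos ⟨by lia, by lia⟩, Category.assoc, Category.assoc, eqToHom_trans,
    key _ (Fin.ext (by dsimp only; lia)), eqToHom_trans_assoc]

variable (A N) in
/-- Restricting the extension by zero of a diagram recovers the diagram. -/
def restrictExtIso : extFunctor A (N - 2) ⋙ restrict A N ≅ 𝟭 _ :=
  NatIso.ofComponents (fun X => NatIso.ofComponents (fun i => eqToIso (extObj_succ X i))
    fun f => extMap_succ X f (by have : (_ : ℕ) ≤ _ := leOfHom f; lia)) fun f => by
      ext i
      exact extHomApp_succ f i

lemma full_extFunctor (hN : 2 ≤ N) : (extFunctor A (N - 2)).Full where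
  map_surjective {X Y} φ := by
    refine ⟨(restrictExtIso A N).inv.app X ≫ (restrict A N).map φ ≫
      (restrictExtIso A N).hom.app Y, (isConcentrated_extFunctor hN X).hom_ext ?_⟩
    rw [← cancel_mono ((restrictExtIso A N).hom.app Y)]
    refine ((restrictExtIso A N).hom.naturality _).trans ?_
    simp only [Functor.id_map, Iso.hom_inv_id_app_assoc]

variable (A N) in
lemma faithful_extFunctor : (extFunctor A (N - 2)).Faithful :=
  have : (extFunctor A (N - 2) ⋙ restrict A N).Faithful :=
    Functor.Faithful.of_iso (restrictExtIso A N).symm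
  Functor.Faithful.of_comp _ (restrict A N)

lemma full_G (hN : 2 ≤ N) : (G A N hN).Full :=
  have := full_extFunctor (A := A) hN
  Functor.Full.of_comp_faithful_iso (F := G A N hN) (G := (isNComplex A N ⊓ isBounded A).ι)
    (H := extFunctor A (N - 2)) (Iso.refl _)

lemma faithful_G (hN : 2 ≤ N) : (G A N hN).Faithful :=
  have := faithful_extFunctor A N
  Functor.Faithful.of_comp_iso (F := G A N hN) (G := (isNComplex A N ⊓ isBounded A).ι)
    (H := extFunctor A (N - 2)) (Iso.refl _)

/-- The component of `toExtRestrict` in a given degree. -/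
def toExtRestrictApp (N : ℕ) (M : ℤ ⥤ A) (n : ℤ) :
    M.obj n ⟶ extObj ((restrict A N).obj M) n :=
  if h : 1 ≤ n ∧ n ≤ ((N - 2 : ℕ) : ℤ) + 1 then
    toRestrict N M n h ≫ eqToHom (extObj_eq ((restrict A N).obj M) n h).symm
  else 0

lemma d_toExtRestrictApp (hN : 2 ≤ N) {M : ℤ ⥤ A} (hM : IsConcentrated N M) (m n : ℤ)
    (hmn : m ≤ n) : d M m n hmn ≫ toExtRestrictApp N M n =
      toExtRestrictApp N M m ≫ extMap ((restrict A N).obj M) m n hmn := by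
  by_cases h : 1 ≤ m ∧ n ≤ ((N - 2 : ℕ) : ℤ) + 1
  · rw [toExtRestrictApp, toExtRestrictApp, extMap, dif_pos h, dif_pos ⟨by lia, by lia⟩,
      dif_pos ⟨by lia, by lia⟩, Category.assoc, eqToHom_trans_assoc, eqToHom_refl,
      Category.id_comp, ← Category.assoc, ← Category.assoc,
      d_toRestrict M m n ⟨by lia, by lia⟩ ⟨by lia, by lia⟩ hmn]
  · by_cases h1 : 1 ≤ m
    · exact (isZero_extObj _ n (by lia)).eq_of_tgt _ _
    · exact (hM m (by lia)).eq_of_src _ _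

/-- A sequence concentrated in the degrees `1, …, N - 1` is the extension by zero of its
restriction to these degrees. -/
def toExtRestrict (hN : 2 ≤ N) {M : ℤ ⥤ A} (hM : IsConcentrated N M) :
    M ⟶ (extFunctor A (N - 2)).obj ((restrict A N).obj M) where
  app := toExtRestrictApp N M
  naturality m n a := d_toExtRestrictApp hN hM m n (leOfHom a)

lemma isIso_toExtRestrict (hN : 2 ≤ N) {M : ℤ ⥤ A} (hM : IsConcentrated N M) :
    IsIso (toExtRestrict hN hM) := by
  rw [NatTrans.isIso_iff_isIso_app]
  intro n
  by_cases h : 1 ≤ n ∧ n ≤ ((N - 2 : ℕ) : ℤ) + 1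
  · change IsIso (toExtRestrictApp N M n)
    rw [toExtRestrictApp, dif_pos h]
    infer_instance
  · exact (hM n (by lia)).isIso (isZero_extObj _ n h) _

lemma extHomApp_toExtRestrictApp {M M' : ℤ ⥤ A} (f : M ⟶ M') (n : ℤ) :
    f.app n ≫ toExtRestrictApp N M' n =
      toExtRestrictApp N M n ≫ extHomApp ((restrict A N).map f) n := by
  by_cases h : 1 ≤ n ∧ n ≤ ((N - 2 : ℕ) : ℤ) + 1
  · rw [toExtRestrictApp, toExtRestrictApp, extHomApp, dif_pos h, dif_pos h, dif_pos h,
      Category.assoc, eqToHom_trans_assoc, eqToHom_refl, Category.id_comp, ← Category.assoc,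
      ← Category.assoc, app_toRestrict]
  · exact (isZero_extObj _ n h).eq_of_tgt _ _

lemma toExtRestrict_naturality {M M' : ℤ ⥤ A} (hN : 2 ≤ N) (hM : IsConcentrated N M)
    (hM' : IsConcentrated N M') (f : M ⟶ M') : f ≫ toExtRestrict hN hM' =
      toExtRestrict hN hM ≫ (extFunctor A (N - 2)).map ((restrict A N).map f) := by
  ext n
  exact extHomApp_toExtRestrictApp f n

lemma IsConcentrated.isIso_truncι {M : ℤ ⥤ A} (hM : IsConcentrated N M) : IsIso (truncι N M) := by
  rw [NatTrans.isIso_iff_isIso_app]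
  intro i
  obtain ⟨s, hs⟩ := exists_truncLift (N := N) (K := M) (i := i) (c := max i N) (by lia) le_rfl
    (𝟙 _) ((hM _ (by lia)).eq_of_tgt _ _)
  exact ⟨s, by rw [← cancel_mono ((truncι N M).app i), Category.assoc, hs, Category.comp_id,
    Category.id_comp], hs⟩

lemma isIso_quoπ {M : ℤ ⥤ A} (hM : ∀ n ≤ 0, IsZero (M.obj n)) : IsIso (quoπ M) := by
  rw [NatTrans.isIso_iff_isIso_app]
  intro i
  have : Mono ((quoπ M).app i) := Preadditive.mono_of_cancel_zero _ fun {T} x hx => by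
    obtain ⟨T', π, _, y, hy⟩ := exists_of_comp_quoπ_eq_zero (c := min i 0) (by lia) le_rfl x hx
    rw [← cancel_epi π, hy, (hM _ (by lia)).eq_of_tgt y 0, zero_comp, comp_zero]
  exact isIso_of_mono_of_epi _

end Extension

/-! ### The derived category -/

section Derived

variable (A : Type u) [Category.{v} A] [Abelian A] (N : ℕ)

/-- The functor sending `K` to the diagram of the homology objects of `K^0 ⟶ K^i ⟶ K^N`, for
`1 ≤ i < N`. -/
def coreDiagram : BoundedNComplex A N ⥤ ComposableArrows A (N - 2) :=
  coreFunctor A N ⋙ restrict A N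

variable {A N} in
/-- The projection of the truncation of a sequence to its core, regarded as an extension by zero. -/
def toCore (hN : 2 ≤ N) (K : ℤ ⥤ A) :
    trunc N K ⟶ (extFunctor A (N - 2)).obj ((restrict A N).obj (core N K)) :=
  quoπ _ ≫ toExtRestrict hN (isConcentrated_core K)

variable {A N} in
lemma toCore_naturality (hN : 2 ≤ N) {K L : ℤ ⥤ A} (f : K ⟶ L) :
    truncMap N f ≫ toCore hN L =
      toCore hN K ≫ (extFunctor A (N - 2)).map ((restrict A N).map (coreMap N f)) := by
  rw [toCore, toCore, Category.assoc, ← toExtRestrict_naturality hN (isConcentrated_core K)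
      (isConcentrated_core L), ← Category.assoc, ← Category.assoc, quoπ_map]

/-- The natural projection of the truncation of a complex to its core. -/
def truncToCore (hN : 2 ≤ N) : truncFunctor A N ⟶ coreDiagram A N ⋙ G A N hN where
  app K := ObjectProperty.homMk (toCore hN K.obj)
  naturality _ _ f := ObjectProperty.hom_ext _ (toCore_naturality hN f.hom)

variable {A N}

lemma isIso_truncFunctorι_G (hN : 2 ≤ N) (X : ComposableArrows A (N - 2)) :
    IsIso ((truncFunctorι A N).app ((G A N hN).obj X)) := by
  rw [← ObjectProperty.isIso_hom_iff]
  exact (isConcentrated_extFunctor hN X).isIso_truncι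

lemma IsConcentrated.isIso_toCore (hN : 2 ≤ N) {M : ℤ ⥤ A} (hM : IsConcentrated N M) :
    IsIso (toCore hN M) := by
  have := hM.isIso_truncι
  have := isIso_quoπ (M := trunc N M) fun n hn =>
    (hM n (by lia)).of_iso (asIso ((truncι N M).app n))
  have := isIso_toExtRestrict hN (isConcentrated_core (N := N) M)
  rw [toCore]
  infer_instance

lemma isIso_truncToCore_G (hN : 2 ≤ N) (X : ComposableArrows A (N - 2)) :
    IsIso ((truncToCore A N hN).app ((G A N hN).obj X)) := by
  rw [← ObjectProperty.isIso_hom_iff]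
  exact (isConcentrated_extFunctor hN X).isIso_toCore hN

/-- A diagram is recovered from the core of its extension by zero. -/
lemma exists_iso_coreDiagram (hN : 2 ≤ N) : ∃ t : 𝟭 _ ≅ G A N hN ⋙ coreDiagram A N, ∀ X,
    (truncFunctorι A N).app ((G A N hN).obj X) ≫ (G A N hN).map (t.hom.app X) =
      (truncToCore A N hN).app ((G A N hN).obj X) := by
  have := full_G (A := A) hN
  have := faithful_G (A := A) hN
  have := isIso_truncFunctorι_G (A := A) hN
  have := isIso_truncToCore_G (A := A) hN
  let e (X : ComposableArrows A (N - 2)) :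
      (G A N hN).obj X ≅ (G A N hN).obj ((G A N hN ⋙ coreDiagram A N).obj X) :=
    (asIso ((truncFunctorι A N).app ((G A N hN).obj X))).symm ≪≫
      asIso ((truncToCore A N hN).app ((G A N hN).obj X))
  let u (X : ComposableArrows A (N - 2)) : X ≅ (G A N hN ⋙ coreDiagram A N).obj X :=
    (G A N hN).preimageIso (e X)
  have hu (X) : (G A N hN).map (u X).hom = inv ((truncFunctorι A N).app ((G A N hN).obj X)) ≫
      (truncToCore A N hN).app ((G A N hN).obj X) := (G A N hN).map_preimage _
  refine ⟨NatIso.ofComponents u fun {X Y} f => ?_, fun X => ?_⟩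
  · apply (G A N hN).map_injective
    have h₁ := (truncFunctorι A N).naturality ((G A N hN).map f)
    have h₂ := (truncToCore A N hN).naturality ((G A N hN).map f)
    rw [Functor.map_comp, Functor.map_comp]
    change (G A N hN).map f ≫ (G A N hN).map (u Y).hom =
      (G A N hN).map (u X).hom ≫ (coreDiagram A N ⋙ G A N hN).map ((G A N hN).map f)
    rw [hu, hu, Category.assoc, ← h₂, ← cancel_epi ((truncFunctorι A N).app ((G A N hN).obj X)),
      IsIso.hom_inv_id_assoc, ← Category.assoc]
    refine (congrArg (· ≫ _) h₁.symm).trans ?_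
    rw [Category.assoc, IsIso.hom_inv_id_assoc]
  · change _ ≫ (G A N hN).map (u X).hom = _
    rw [hu, IsIso.hom_inv_id_assoc]

lemma truncMap_sub {K L : ℤ ⥤ A} (f g : K ⟶ L) :
    truncMap N (f - g) = truncMap N f - truncMap N g := by
  rw [← cancel_mono (truncι N L), Preadditive.sub_comp, truncMap_ι, truncMap_ι, truncMap_ι,
    Preadditive.comp_sub]

lemma quoMap_sub {K L : ℤ ⥤ A} (f g : K ⟶ L) : quoMap (f - g) = quoMap f - quoMap g := by
  rw [← cancel_epi (quoπ K), Preadditive.comp_sub, quoπ_map, quoπ_map, quoπ_map,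
    Preadditive.sub_comp]

lemma homotopic_truncFunctor {X Y : BoundedNComplex A N} (f g : X ⟶ Y) (h : homotopic A N f g) :
    homotopic A N ((truncFunctor A N).map f) ((truncFunctor A N).map g) := by
  have e : (truncFunctor A N).map f - (truncFunctor A N).map g = (truncFunctor A N).map (f - g) :=
    ObjectProperty.hom_ext _ (truncMap_sub f.hom g.hom).symm
  change NullHomotopic (_ - _)
  rw [e]
  exact NullHomotopic.trunc h

lemma coreFunctor_map_eq {X Y : BoundedNComplex A N} (f g : X ⟶ Y) (h : homotopic A N f g) :
    (coreFunctor A N).map f = (coreFunctor A N).map g := by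
  have h₀ : coreMap N (f.hom - g.hom) = 0 := coreMap_eq_zero (show NullHomotopic (f - g) from h)
  rw [coreMap, truncMap_sub, quoMap_sub, sub_eq_zero] at h₀
  exact h₀

/-- A functor `F` is fully faithful if it has a natural retraction `Ψ` up to isomorphism, and if
each object `Y` of the target is linked to `F (Ψ Y)` by a natural span `Y ⟵ E Y ⟶ F (Ψ Y)` that for
`Y = F X` is made of isomorphisms compatible with the retraction: a morphism `f : F X ⟶ F Y` is
then conjugate to `F (Ψ f)`. -/
lemma full_and_faithful_of_span {M D : Type*} [Category* M] [Category* D] (F : M ⥤ D) (Ψ : D ⥤ M)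
    (E : D ⥤ D) (ι : E ⟶ 𝟭 D) (q : E ⟶ Ψ ⋙ F) (t : 𝟭 M ≅ F ⋙ Ψ)
    (hι : ∀ X, IsIso (ι.app (F.obj X)))
    (hq : ∀ X, ι.app (F.obj X) ≫ F.map (t.hom.app X) = q.app (F.obj X)) :
    F.Full ∧ F.Faithful := by
  refine ⟨⟨fun {X Y} f => ⟨t.hom.app X ≫ Ψ.map f ≫ t.inv.app Y, ?_⟩⟩, ⟨fun {X Y} f g h => ?_⟩⟩
  · have h₁ : E.map f ≫ ι.app _ = ι.app _ ≫ f := ι.naturality f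
    have h₂ : E.map f ≫ q.app _ = q.app _ ≫ F.map (Ψ.map f) := q.naturality f
    rw [← hq, ← hq, reassoc_of% h₁, Category.assoc, cancel_epi, ← F.map_comp] at h₂
    rw [← Category.assoc, F.map_comp, ← h₂, Category.assoc, ← F.map_comp, t.hom_inv_id_app]
    simp
  · have h₁ : f ≫ t.hom.app Y = t.hom.app X ≫ Ψ.map (F.map f) := t.hom.naturality f
    have h₂ : g ≫ t.hom.app Y = t.hom.app X ≫ Ψ.map (F.map g) := t.hom.naturality g
    rw [← cancel_mono (t.hom.app Y), h₁, h₂, h]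

/-- The version of `full_and_faithful_of_span` for a localization `L : C ⥤ D`, with all data given
before localizing. -/
lemma full_and_faithful_of_span_localization {M C D : Type*} [Category* M] [Category* C]
    [Category* D] (L : C ⥤ D) (W : MorphismProperty C) [L.IsLocalization W] (F : M ⥤ C) (Ψ : C ⥤ M)
    (E : C ⥤ D) (hΨ : W.IsInvertedBy Ψ) (hE : W.IsInvertedBy E) (ι : E ⟶ L) (q : E ⟶ Ψ ⋙ F ⋙ L)
    (t : 𝟭 M ≅ F ⋙ Ψ) (hι : ∀ X, IsIso (ι.app (F.obj X)))
    (hq : ∀ X, ι.app (F.obj X) ≫ L.map (F.map (t.hom.app X)) = q.app (F.obj X)) :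
    (F ⋙ L).Full ∧ (F ⋙ L).Faithful := by
  let ψ : L ⋙ Localization.lift Ψ hΨ L ≅ Ψ := Localization.fac Ψ hΨ L
  let ε : L ⋙ Localization.lift E hE L ≅ E := Localization.fac E hE L
  let ι' : Localization.lift E hE L ⟶ 𝟭 D := Localization.liftNatTrans L W E L _ _ ι
  let q' : Localization.lift E hE L ⟶ Localization.lift Ψ hΨ L ⋙ F ⋙ L :=
    Localization.liftNatTrans L W E (Ψ ⋙ F ⋙ L) _ _ q
  have hι' (K : C) : ι'.app (L.obj K) = ε.hom.app K ≫ ι.app K :=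
    (Localization.liftNatTrans_app L W E L _ _ ι K).trans
      (congrArg (_ ≫ ·) (Category.comp_id _))
  have hq' (K : C) : q'.app (L.obj K) = ε.hom.app K ≫ q.app K ≫ (F ⋙ L).map (ψ.inv.app K) :=
    Localization.liftNatTrans_app L W E (Ψ ⋙ F ⋙ L) _ _ q K
  refine full_and_faithful_of_span (F ⋙ L) (Localization.lift Ψ hΨ L) (Localization.lift E hE L)
    ι' q' (t ≪≫ Functor.isoWhiskerLeft F ψ.symm) (fun X => ?_) fun X => ?_
  · refine (hι' (F.obj X)).symm ▸ ?_
    infer_instance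
  · refine (congrArg (· ≫ _) (hι' (F.obj X))).trans ((hq' (F.obj X)).trans ?_).symm
    rw [← hq]
    simp [ψ]

lemma full_and_faithful_G_toDerivedCat (hN : 2 ≤ N) :
    (G A N hN ⋙ toDerivedCat A N).Full ∧ (G A N hN ⋙ toDerivedCat A N).Faithful := by
  let E : HomotopyCat A N ⥤ DerivedCat A N :=
    CategoryTheory.Quotient.lift _ (truncFunctor A N ⋙ toDerivedCat A N) fun _ _ f g h =>
      congrArg (acyclicCone A N).Q.map
        (CategoryTheory.Quotient.sound _ (homotopic_truncFunctor f g h))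
  let Ψ : HomotopyCat A N ⥤ ComposableArrows A (N - 2) :=
    CategoryTheory.Quotient.lift _ (coreDiagram A N) fun _ _ f g h =>
      congrArg (restrict A N).map (coreFunctor_map_eq f g h)
  have hE : (acyclicCone A N).IsInvertedBy E := isInvertedBy_acyclicCone _ fun X Y f hf =>
    QuasiIso.isIso_map_toDerivedCat (f := (truncFunctor A N).map f) (by lia)
      (hf.trunc X.property.1 Y.property.1)
  have hΨ : (acyclicCone A N).IsInvertedBy Ψ := isInvertedBy_acyclicCone _ fun X Y f hf => by
    have : IsIso ((coreFunctor A N).map f) := hf.isIso_coreMap X.property.1 Y.property.1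
    exact inferInstanceAs (IsIso ((restrict A N).map ((coreFunctor A N).map f)))
  let ι : E ⟶ (acyclicCone A N).Q := CategoryTheory.Quotient.natTransLift _
    (Functor.whiskerRight (truncFunctorι A N) (toDerivedCat A N))
  let q : E ⟶ Ψ ⋙ (G A N hN ⋙ toHomotopyCat A N) ⋙ (acyclicCone A N).Q :=
    CategoryTheory.Quotient.natTransLift _
      (Functor.whiskerRight (truncToCore A N hN) (toDerivedCat A N))
  obtain ⟨t, ht⟩ := exists_iso_coreDiagram (A := A) hN
  refine full_and_faithful_of_span_localization (acyclicCone A N).Q (acyclicCone A N)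
    (G A N hN ⋙ toHomotopyCat A N) Ψ E hΨ hE ι q t (fun X => ?_) fun X => ?_
  · have := isIso_truncFunctorι_G hN X
    exact inferInstanceAs
      (IsIso ((toDerivedCat A N).map ((truncFunctorι A N).app ((G A N hN).obj X))))
  · exact ((toDerivedCat A N).map_comp _ _).symm.trans (congrArg (toDerivedCat A N).map (ht X))

end Derived

end NCx

end

theorem mainTheorem8 {A : Type u} [Category.{v} A] [Abelian A] (N : ℕ) (hN : 2 ≤ N) :
    (NCx.G A N hN ⋙ NCx.toDerivedCat A N).Full ∧
    (NCx.G A N hN ⋙ NCx.toDerivedCat A N).Faithful ∧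
    (∀ X : ComposableArrows A (N - 2),
      (∀ n : ℤ, ¬ (1 ≤ n ∧ n ≤ (N : ℤ) - 1) → IsZero (((NCx.G A N hN).obj X).obj.obj n)) ∧
      Nonempty (NCx.degreeInclusion N ⋙ ((NCx.G A N hN).obj X).obj ≅ X)) := by
  obtain ⟨hfull, hfaithful⟩ := NCx.full_and_faithful_G_toDerivedCat (A := A) hN
  exact ⟨hfull, hfaithful, fun X => ⟨NCx.isConcentrated_extFunctor hN X,
    ⟨(NCx.restrictExtIso A N).app X⟩⟩⟩
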